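/- Let $0<\alpha<1$ and $c_0,c_1,c_2>0$, let $(\omega_n)_{n\ge1}$ be positive numbers with $\omega_n\to\infty$, and let $(m_n)_{n\ge 1}$ be non-negative integers. For every $n$ let $P_{n1},\dots,P_{nn}$ be probability distributions on $\{0,1,\dots,m_n\}$ and let $S_n(v_1),\dots,S_n(v_n)$ be independent random subsets of $W_n=\{w_1,\dots,w_{m_n}\}$ with $$\mathbf P(S_n(v_i)=A)=\binom{m_n}{|A|}^{-1}P_{ni}(\{|A|\}),\qquad A\subset W_n .$$ Let $G_n$ be the random intersection graph on $V_n=\{v_1,\dots,v_n\}$ in which distinct $v_i,v_j$ are adjacent iff $S_n(v_i)\cap S_n(v_j)\ne\emptyset$. Write $\tilde Z_{ni}=|S_n(v_i)|\sqrt{n/m_n}$ for the normalized weight of $v_i$, and call $u\in V_n$ maximal if $|S_n(u)|=\max_{v\in V_n}|S_n(v)|$. Let $C_1=C_1(G_n)$ be the vertex set of a largest connected component of $G_n$ (in case of ties, the events below are required to hold for every largest component). Assume that (i) $n\ln^2 n=o(m_n)$ as $n\to\infty$; (ii) there is $n_0$ such that for all $n>n_0$, all $t\in[c_0,\,n^{1/(1+\alpha)}\omega_n]$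 and all $i\in\{1,\dots,n\}$, $$c_1t^{-1-\alpha}\le \mathbf P(\tilde Z_{ni}>t)\le c_2t^{-1-\alpha}.$$ Then the following hold as $n\to\infty$. 1. There is $\rho\in(0,1)$ such that $\mathbf P(|C_1|>\rho n)\to1$. 2. $\mathbf P(\text{every maximal vertex of } G_n \text{ belongs to } C_1)\to 1$. In particular, $\mathbf P(u_n\in C_1)\to1$ for every sequence of random vertices $u_n$ such that $u_n$ is maximal in $G_n$. 3. Let $V_n^0=\{v_i\in V_n:\tilde Z_{ni}>n^{1/(1+\alpha)}/(\ln\ln n)^{\alpha}\}$. Then $\mathbf P(V_n^0\subset C_1)\to1$ and $\mathbf P\bigl(|V_n^0|\ge 2c_2(\ln\ln n)^{\alpha(1+\alpha)}\bigr)\to0$. -/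

import Mathlib

open Filter Topology MeasureTheory ProbabilityTheory Asymptotics

/-- The intersection graph of a family of finite sets: distinct vertices `i`, `j` are adjacent
iff `S i` and `S j` intersect. -/
def intersectionGraph {V W : Type*} [DecidableEq W] (S : V → Finset W) : SimpleGraph V where
  Adj i j := i ≠ j ∧ (S i ∩ S j).Nonempty
  symm := ⟨fun i j h => ⟨h.1.symm, by rw [Finset.inter_comm]; exact h.2⟩⟩
  loopless := ⟨fun _ h => h.1 rfl⟩

/-- `S 0, …, S (n - 1)` are independent random subsets of a set of `m` elements, and `S i` is a
mixture of uniform distributions with size distribution `P i` on `{0, …, m}`, that is,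
`ℙ(S i = A) = P i |A| / (m choose |A|)` for every `A`. -/
structure IsRandomIntersectionModel {Ω : Type*} [MeasurableSpace Ω] (μ : Measure Ω) (n m : ℕ)
    (P : Fin n → PMF (Fin (m + 1))) (S : Fin n → Ω → Finset (Fin m)) : Prop where
  measurable : ∀ i (A : Finset (Fin m)), MeasurableSet {ω | S i ω = A}
  indep : iIndepFun (m := fun _ : Fin n => (⊤ : MeasurableSpace (Finset (Fin m)))) S μ
  law : ∀ i (A : Finset (Fin m)),
    μ {ω | S i ω = A} =
      P i ⟨A.card, Nat.lt_succ_of_le (card_finset_fin_le A)⟩ / (m.choose A.card : ENNReal)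

/-- `C` is the vertex set of a connected component having the largest possible number of
vertices. -/
def IsLargestComponent {V : Type*} (G : SimpleGraph V) (C : Set V) : Prop :=
  ∃ c : G.ConnectedComponent, c.supp = C ∧
    ∀ c' : G.ConnectedComponent, c'.supp.ncard ≤ c.supp.ncard

/-- The normalized weight `|A| √(n/m)` of a vertex with attribute set `A`. -/
noncomputable def normalizedWeight (n m : ℕ) (A : Finset (Fin m)) : ℝ :=
  (A.card : ℝ) * Real.sqrt ((n : ℝ) / (m : ℝ))

/-- A vertex is maximal if its attribute set has the largest size. -/
def IsMaximalVertex {V W : Type*} (S : V → Finset W) (u : V) : Prop :=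
  ∀ v, (S v).card ≤ (S u).card

/-- The set of vertices whose normalized weight exceeds `n ^ (1/(1+α)) / (ln ln n) ^ α`. -/
noncomputable def heavyVertices (α : ℝ) {n m : ℕ} (S : Fin n → Finset (Fin m)) : Set (Fin n) :=
  {i | (n : ℝ) ^ (1 / (1 + α)) / (Real.log (Real.log n)) ^ α < normalizedWeight n m (S i)}

/-! Scale weights by `r = √(n/m)`, so that `r² m = n`. Fix a large constant `K` and put `η = c₁
K^(-1-α) / 4`. By Chebyshev about `4ηn` or more vertices weigh over `K`. If the sets of such
vertices hardly overlap, any `k ≈ ηn` of them cover at least `ηKn/(2r)` attributes, and `k` further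
ones all avoid this union with conditional probability at most `exp(-kηK²/2)`. As `ηK²` is of order
`K^(1-α)` and `α < 1`, a large `K` beats the choice of the two `k`-sets. So any two disjoint
`k`-sets are joined, and `exists_component_of_dense` yields a component of linear size.

A largest component also covers many attributes. With `δ = 1 / ln n`, first moments show that few
vertices of weight at most `δ` have a neighbour, so at least `ρn/2` of its vertices weigh over `δ`;
up to overlaps they cover order `δn/r` attributes. The total overlap has mean `O(n)` after
truncation, negligible against `δn/r` precisely because `r/δ = √(n ln² n / m) → 0`, which is (i). A
vertex `u` of weight over `τ` outside a component is independent of the component's attributes,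
which do not change when `S u` is emptied, so it misses them with probability at most `exp(-τδρ/4) ≤
n⁻³`; a union bound over `n²` pairs finishes (`real_exists_missed_component_le`).

The tail at `τ = n^(1/(1+α)) / (ln ln n)^α` is `(ln ln n)^(α(1+α)) / n` up to constants. Chebyshev
bounds the number of heavier vertices, and shows that some exist, so maximal vertices are among
them. Everything is collected in `real_not_largest_contains_heavy_le`. -/

section FiniteProbability

variable {Ω : Type*} [MeasurableSpace Ω] {μ : Measure Ω} [IsProbabilityMeasure μ]

theorem measureReal_eq_sum_fiber {β : Type*} [Fintype β] [DecidableEq β] {Y : Ω → β}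
    (hY : ∀ b, MeasurableSet {ω | Y ω = b}) (Q : β → Prop) [DecidablePred Q] :
    μ.real {ω | Q (Y ω)} = ∑ b, if Q b then μ.real {ω | Y ω = b} else 0 := by
  rw [← Finset.sum_filter, ← measureReal_biUnion_finset]
  · congr 1
    ext ω
    simp
  · intro a _ b _ hab
    refine Set.disjoint_left.2 fun ω h1 h2 => hab ?_
    exact h1.symm.trans h2
  · exact fun b _ => hY b

theorem integral_comp_eq_sum_fiber {β : Type*} [Fintype β] [DecidableEq β] {Y : Ω → β}
    (hY : ∀ b, MeasurableSet {ω | Y ω = b}) (g : β → ℝ) :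
    Integrable (fun ω => g (Y ω)) μ ∧
    ∫ ω, g (Y ω) ∂μ = ∑ b, μ.real {ω | Y ω = b} * g b := by
  have h1 : (fun ω => g (Y ω)) =
      fun ω => ∑ b, Set.indicator {ω | Y ω = b} (fun _ => g b) ω := by
    funext ω
    simp [Set.indicator_apply]
  rw [h1]
  have hi : ∀ b, Integrable (Set.indicator {ω | Y ω = b} (fun _ => g b)) μ := fun b =>
    (integrable_const _).indicator (hY b)
  refine ⟨integrable_finsetSum _ fun b _ => hi b, ?_⟩
  rw [integral_finsetSum _ fun b _ => hi b]
  refine Finset.sum_congr rfl fun b _ => ?_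
  rw [integral_indicator_const _ (hY b), smul_eq_mul]

/-- Markov's inequality for the number of occurring events. -/
theorem markov_card {ι : Type*} (I : Finset ι) (E : ι → Set Ω)
    (hE : ∀ i ∈ I, MeasurableSet (E i)) (c : ℝ) [∀ ω, DecidablePred fun i => ω ∈ E i] :
    c * μ.real {ω | c ≤ ((I.filter fun i => ω ∈ E i).card : ℝ)} ≤ ∑ i ∈ I, μ.real (E i) := by
  have h1 : (fun ω => ((I.filter fun i => ω ∈ E i).card : ℝ)) =
      fun ω => ∑ i ∈ I, Set.indicator (E i) (fun _ => (1 : ℝ)) ω := by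
    funext ω
    rw [Finset.card_filter]
    push_cast
    exact Finset.sum_congr rfl fun i _ => by simp [Set.indicator_apply]
  have hi : ∀ i ∈ I, Integrable (Set.indicator (E i) (fun _ => (1 : ℝ))) μ := fun i hiI =>
    (integrable_const _).indicator (hE i hiI)
  have h2 : Integrable (fun ω => ((I.filter fun i => ω ∈ E i).card : ℝ)) μ := by
    rw [h1]; exact integrable_finsetSum _ hi
  refine (mul_meas_ge_le_integral_of_nonneg
    (Filter.Eventually.of_forall fun ω => Nat.cast_nonneg _) h2 c).trans ?_
  rw [h1, integral_finsetSum _ hi]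
  refine Finset.sum_le_sum fun i hiI => ?_
  rw [integral_indicator_const _ (hE i hiI)]
  simp

end FiniteProbability

/-! ### Probability that a uniform set avoids given attributes -/

/-- Each factor of the quotient of falling factorials satisfies `(m - w - j) / (m - j) ≤ (m - w) /
m`. Truncated subtraction makes the degenerate ranges trivial. -/
theorem choose_sub_mul_pow_le (m w a : ℕ) :
    (m - w).choose a * m ^ a ≤ m.choose a * (m - w) ^ a := by
  induction a with
  | zero => simp
  | succ a ih =>
    have h1 : (m - w - a) * m ≤ (m - a) * (m - w) := by
      rcases le_total w m with hw | hw
      · rcases le_total a (m - w) with ha | ha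
        · obtain ⟨r, rfl⟩ := Nat.exists_eq_add_of_le hw
          simp only [Nat.add_sub_cancel_left] at ha ⊢
          obtain ⟨s, rfl⟩ := Nat.exists_eq_add_of_le ha
          have : w + (a + s) - a = w + s := by omega
          rw [this, Nat.add_sub_cancel_left]
          nlinarith
        · simp [Nat.sub_eq_zero_of_le ha]
      · simp [Nat.sub_eq_zero_of_le hw]
    have e1 := Nat.choose_succ_right_eq (m - w) a
    have e2 := Nat.choose_succ_right_eq m a
    refine Nat.le_of_mul_le_mul_right (c := a + 1) ?_ (Nat.succ_pos a)
    calc (m - w).choose (a + 1) * m ^ (a + 1) * (a + 1)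
        = ((m - w).choose (a + 1) * (a + 1)) * m ^ a * m := by ring
      _ = ((m - w).choose a * m ^ a) * ((m - w - a) * m) := by rw [e1]; ring
      _ ≤ (m.choose a * (m - w) ^ a) * ((m - a) * (m - w)) := Nat.mul_le_mul ih h1
      _ = (m.choose a * (m - a)) * (m - w) ^ a * (m - w) := by ring
      _ = (m.choose (a + 1) * (a + 1)) * (m - w) ^ a * (m - w) := by rw [e2]
      _ = m.choose (a + 1) * (m - w) ^ (a + 1) * (a + 1) := by ring

theorem choose_sub_le_choose_mul_exp {m w : ℕ} (hw : w ≤ m) (a : ℕ) :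
    ((m - w).choose a : ℝ) ≤ m.choose a * Real.exp (-(a * w / m : ℝ)) := by
  rcases Nat.eq_zero_or_pos m with rfl | hm
  · have : w = 0 := by omega
    subst this; simp
  have hm' : (0 : ℝ) < m := by exact_mod_cast hm
  have h := choose_sub_mul_pow_le m w a
  have h' : ((m - w).choose a : ℝ) * (m : ℝ) ^ a ≤ m.choose a * ((m : ℝ) - w) ^ a := by
    rw [← Nat.cast_sub hw]; exact_mod_cast h
  have h2 : ((m : ℝ) - w) ≤ m * Real.exp (-(w / m : ℝ)) := by
    have := Real.add_one_le_exp (-(w / m : ℝ))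
    calc (m : ℝ) - w = m * (-(w / m : ℝ) + 1) := by field_simp; ring
      _ ≤ _ := by gcongr
  have h3 : ((m : ℝ) - w) ^ a ≤ (m : ℝ) ^ a * Real.exp (-(a * w / m : ℝ)) := by
    have h0 : (0 : ℝ) ≤ (m : ℝ) - w := by
      have : (w : ℝ) ≤ m := by exact_mod_cast hw
      linarith
    calc ((m : ℝ) - w) ^ a ≤ (m * Real.exp (-(w / m : ℝ))) ^ a := by gcongr
      _ = _ := by rw [mul_pow, ← Real.exp_nat_mul]; congr 2; ring
  have hp : (0 : ℝ) < (m : ℝ) ^ a := by positivity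
  refine le_of_mul_le_mul_right ?_ hp
  calc _ ≤ _ := h'
    _ ≤ m.choose a * ((m : ℝ) ^ a * Real.exp (-(a * w / m : ℝ))) := by gcongr
    _ = _ := by ring

/-! ### Independence, conditioning, exchangeability and concentration in the model -/

namespace IsRandomIntersectionModel

variable {Ω : Type*} [MeasurableSpace Ω] {μ : Measure Ω} {n m : ℕ}
  {P : Fin n → PMF (Fin (m + 1))} {S : Fin n → Ω → Finset (Fin m)}

theorem measurableSet_tuple (h : IsRandomIntersectionModel μ n m P S)
    (A : Fin n → Finset (Fin m)) : MeasurableSet {ω | (fun i => S i ω) = A} := by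
  have : {ω | (fun i => S i ω) = A} = ⋂ i, {ω | S i ω = A i} := by
    ext ω; simp [funext_iff]
  rw [this]
  exact MeasurableSet.iInter fun i => h.measurable i _

/-- The tuple takes finitely many values, so every event about it is a finite union of the fibres
assumed measurable. -/
theorem measurableSet_event (h : IsRandomIntersectionModel μ n m P S)
    (Q : (Fin n → Finset (Fin m)) → Prop) : MeasurableSet {ω | Q fun i => S i ω} := by
  classical
  have : {ω | Q fun i => S i ω} = ⋃ A ∈ {A | Q A}, {ω | (fun i => S i ω) = A} := by
    ext ω; simp
  rw [this]
  exact (Set.toFinite _).measurableSet_biUnion fun A _ => h.measurableSet_tuple A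

theorem real_forall_mem (h : IsRandomIntersectionModel μ n m P S) (T : Finset (Fin n))
    (F : Fin n → Set (Finset (Fin m))) :
    μ.real {ω | ∀ i ∈ T, S i ω ∈ F i} = ∏ i ∈ T, μ.real {ω | S i ω ∈ F i} := by
  have h1 := h.indep.measure_inter_preimage_eq_mul T (sets := F) (fun i _ => trivial)
  have h2 : {ω | ∀ i ∈ T, S i ω ∈ F i} = ⋂ i ∈ T, S i ⁻¹' F i := by
    ext ω; simp
  rw [h2, measureReal_def, h1, ENNReal.toReal_prod]
  rfl

theorem real_pair_mem (h : IsRandomIntersectionModel μ n m P S) {u v : Fin n} (huv : u ≠ v)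
    (F G : Set (Finset (Fin m))) :
    μ.real {ω | S u ω ∈ F ∧ S v ω ∈ G} = μ.real {ω | S u ω ∈ F} * μ.real {ω | S v ω ∈ G} := by
  classical
  have := h.real_forall_mem {u, v} (fun i => if i = u then F else G)
  rw [Finset.prod_pair huv] at this
  simpa [huv.symm] using this

theorem real_eq_of_card_eq (h : IsRandomIntersectionModel μ n m P S) (i : Fin n)
    {A B : Finset (Fin m)} (hAB : A.card = B.card) :
    μ.real {ω | S i ω = A} = μ.real {ω | S i ω = B} := by
  rw [measureReal_def, measureReal_def, h.law, h.law]
  simp only [hAB]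

variable [IsProbabilityMeasure μ]

/-- Bounding the probability of an event that involves two disjoint groups of vertices by
conditioning on the attribute sets of the first group. -/
theorem real_cond_le (h : IsRandomIntersectionModel μ n m P S) {T U : Finset (Fin n)}
    (hTU : Disjoint T U) (H : (Fin n → Finset (Fin m)) → Prop)
    (F : (Fin n → Finset (Fin m)) → Fin n → Set (Finset (Fin m))) (c : ℝ)
    (hc : ∀ y, H y → ∏ b ∈ U, μ.real {ω | S b ω ∈ F y b} ≤ c) :
    μ.real {ω | H (fun i => if i ∈ T then S i ω else ∅) ∧
        ∀ b ∈ U, S b ω ∈ F (fun i => if i ∈ T then S i ω else ∅) b} ≤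
      c * μ.real {ω | H (fun i => if i ∈ T then S i ω else ∅)} := by
  classical
  set Y : Ω → Fin n → Finset (Fin m) := fun ω i => if i ∈ T then S i ω else ∅ with hYdef
  have hY : ∀ y, MeasurableSet {ω | Y ω = y} := fun y =>
    h.measurableSet_event (fun A => (fun i => if i ∈ T then A i else ∅) = y)
  have hsub : {ω | H (Y ω) ∧ ∀ b ∈ U, S b ω ∈ F (Y ω) b} ⊆
      ⋃ y ∈ Finset.univ.filter H, {ω | Y ω = y ∧ ∀ b ∈ U, S b ω ∈ F y b} := by
    intro ω hω
    simp only [Set.mem_iUnion]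
    exact ⟨Y ω, by simpa using hω.1, rfl, hω.2⟩
  calc μ.real {ω | H (Y ω) ∧ ∀ b ∈ U, S b ω ∈ F (Y ω) b}
      ≤ μ.real (⋃ y ∈ Finset.univ.filter H, {ω | Y ω = y ∧ ∀ b ∈ U, S b ω ∈ F y b}) :=
        measureReal_mono hsub (measure_ne_top _ _)
    _ ≤ ∑ y ∈ Finset.univ.filter H, μ.real {ω | Y ω = y ∧ ∀ b ∈ U, S b ω ∈ F y b} :=
        measureReal_biUnion_finset_le _ _
    _ ≤ ∑ y ∈ Finset.univ.filter H, c * μ.real {ω | Y ω = y} := by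
        refine Finset.sum_le_sum fun y hy => ?_
        have hHy : H y := by simpa using hy
        by_cases hmask : ∀ i, i ∉ T → y i = ∅
        · have e1 : {ω | Y ω = y} = {ω | ∀ i ∈ T, S i ω ∈ ({y i} : Set (Finset (Fin m)))} := by
            ext ω
            simp only [Set.mem_ofPred_eq, funext_iff, hYdef, Set.mem_singleton_iff]
            refine ⟨fun hh i hi => by simpa [hi] using hh i, fun hh i => ?_⟩
            by_cases hi : i ∈ T
            · simp [hi, hh i hi]
            · simp [hi, hmask i hi]
          have e2 : {ω | Y ω = y ∧ ∀ b ∈ U, S b ω ∈ F y b} =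
              {ω | ∀ i ∈ T ∪ U, S i ω ∈ (if i ∈ T then {y i} else F y i)} := by
            ext ω
            have e1' : Y ω = y ↔ ∀ i ∈ T, S i ω ∈ ({y i} : Set (Finset (Fin m))) :=
              Set.ext_iff.1 e1 ω
            simp only [Set.mem_ofPred_eq, e1', Finset.mem_union]
            constructor
            · rintro ⟨ha, hb⟩ i hi
              by_cases hiT : i ∈ T
              · simpa [hiT] using ha i hiT
              · simpa [hiT] using hb i (hi.resolve_left hiT)
            · intro hh
              refine ⟨fun i hi => by simpa [hi] using hh i (Or.inl hi), fun i hi => ?_⟩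
              have hiT : i ∉ T := fun hiT => Finset.disjoint_left.1 hTU hiT hi
              simpa [hiT] using hh i (Or.inr hi)
          rw [e2, e1, h.real_forall_mem, h.real_forall_mem, Finset.prod_union hTU, mul_comm]
          have p1 : ∏ i ∈ T, μ.real {ω | S i ω ∈ (if i ∈ T then {y i} else F y i)} =
              ∏ i ∈ T, μ.real {ω | S i ω ∈ ({y i} : Set (Finset (Fin m)))} :=
            Finset.prod_congr rfl fun i hi => by simp [hi]
          have p2 : ∏ i ∈ U, μ.real {ω | S i ω ∈ (if i ∈ T then {y i} else F y i)} =
              ∏ i ∈ U, μ.real {ω | S i ω ∈ F y i} :=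
            Finset.prod_congr rfl fun i hi => by
              have hiT : i ∉ T := fun hiT => Finset.disjoint_left.1 hTU hiT hi
              simp [hiT]
          rw [p1, p2]
          exact mul_le_mul_of_nonneg_right (hc y hHy)
            (Finset.prod_nonneg fun i _ => measureReal_nonneg)
        · have e1 : {ω | Y ω = y} = ∅ := by
            ext ω
            simp only [Set.mem_ofPred_eq, Set.mem_empty_iff_false, iff_false]
            rintro rfl
            exact hmask fun i hi => by simp [hYdef, hi]
          have e2 : {ω | Y ω = y ∧ ∀ b ∈ U, S b ω ∈ F y b} = ∅ :=
            Set.subset_eq_empty (fun ω hω => hω.1) e1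
          rw [e1, e2]; simp
    _ = c * μ.real {ω | H (Y ω)} := by
        rw [← Finset.mul_sum, measureReal_eq_sum_fiber hY H, Finset.sum_filter]

/-- Given its size `a`, the set is uniform and avoids `W` with probability at most `exp(-a|W|/m)`;
then sum over the sizes allowed by `Q`, all at least `s`. -/
theorem real_disjoint_le (h : IsRandomIntersectionModel μ n m P S) (i : Fin n) (Q : ℕ → Prop)
    (s : ℝ) (hQ : ∀ a, Q a → s ≤ a) (W : Finset (Fin m)) :
    μ.real {ω | Q (S i ω).card ∧ Disjoint (S i ω) W} ≤
      μ.real {ω | Q (S i ω).card} * Real.exp (-(s * W.card / m)) := by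
  classical
  have hW : W.card ≤ m := card_finset_fin_le W
  -- The common mass of all sets of size `a`, with default 0 when `a > m`; `R` is a dummy argument.
  have size : ∀ (a : ℕ) (R : Finset (Fin m)),
      ∃ q : ℝ, 0 ≤ q ∧ ∀ A : Finset (Fin m), A.card = a → μ.real {ω | S i ω = A} = q := by
    intro a R
    by_cases ha : ∃ A : Finset (Fin m), A.card = a
    · obtain ⟨A, hA⟩ := ha
      exact ⟨_, measureReal_nonneg, fun B hB => h.real_eq_of_card_eq i (hB.trans hA.symm)⟩
    · exact ⟨0, le_rfl, fun A hA => (ha ⟨A, hA⟩).elim⟩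
  choose q hq0 hq using fun a => size a ∅
  have key : ∀ (Q' : Finset (Fin m) → Prop) [DecidablePred Q'], μ.real {ω | Q' (S i ω)} =
      ∑ a ∈ Finset.range (m + 1), q a *
        ((Finset.univ.powersetCard a).filter Q').card := by
    intro Q' _
    rw [measureReal_eq_sum_fiber (h.measurable i), ← Finset.sum_filter,
      ← Finset.sum_fiberwise_of_maps_to (g := Finset.card) (t := Finset.range (m + 1))]
    · refine Finset.sum_congr rfl fun a _ => ?_
      have : (Finset.univ.filter Q').filter (fun A => A.card = a) =
          (Finset.univ.powersetCard a).filter Q' := by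
        ext A; simp [Finset.mem_powersetCard, and_comm]
      rw [this, Finset.sum_congr rfl (g := fun _ => q a), Finset.sum_const, nsmul_eq_mul, mul_comm]
      intro A hA
      refine hq a A ?_
      simp only [Finset.mem_filter, Finset.mem_powersetCard] at hA
      exact hA.1.2
    · intro A _
      exact Finset.mem_range.2 (Nat.lt_succ_of_le (card_finset_fin_le A))
  rw [key (fun A => Q A.card ∧ Disjoint A W), key (fun A => Q A.card), Finset.sum_mul]
  refine Finset.sum_le_sum fun a _ => ?_
  rw [mul_assoc]
  refine mul_le_mul_of_nonneg_left ?_ (hq0 a)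
  by_cases hQa : Q a
  · have e1 : ((Finset.univ : Finset (Fin m)).powersetCard a).filter
        (fun A => Q A.card ∧ Disjoint A W) = (Wᶜ).powersetCard a := by
      ext A
      simp only [Finset.mem_filter, Finset.mem_powersetCard, Finset.subset_univ, true_and,
        Finset.subset_compl_iff_disjoint_right]
      constructor
      · rintro ⟨h1, -, h2⟩; exact ⟨h2, h1⟩
      · rintro ⟨h2, h1⟩; exact ⟨h1, h1 ▸ hQa, h2⟩
    have e2 : ((Finset.univ : Finset (Fin m)).powersetCard a).filter (fun A => Q A.card) =
        Finset.univ.powersetCard a := by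
      refine Finset.filter_true_of_mem fun A hA => ?_
      rw [(Finset.mem_powersetCard.1 hA).2]; exact hQa
    rw [e1, e2, Finset.card_powersetCard, Finset.card_powersetCard, Finset.card_compl,
      Fintype.card_fin, Finset.card_univ, Fintype.card_fin]
    refine (choose_sub_le_choose_mul_exp hW a).trans ?_
    have := hQ a hQa
    gcongr
  · have e1 : ((Finset.univ : Finset (Fin m)).powersetCard a).filter
        (fun A => Q A.card ∧ Disjoint A W) = ∅ := by
      refine Finset.filter_false_of_mem fun A hA hh => hQa ?_
      rw [← (Finset.mem_powersetCard.1 hA).2]; exact hh.1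
    rw [e1]
    simp only [Finset.card_empty, Nat.cast_zero]
    positivity

/-- By symmetry, an attribute belongs to the set of `i` with probability the mean size of this set
divided by `m`, also when restricted to sizes satisfying `Q`. -/
theorem real_mem_eq (h : IsRandomIntersectionModel μ n m P S) (i : Fin n) (Q : ℕ → Prop)
    [DecidablePred Q] (x : Fin m) :
    μ.real {ω | x ∈ S i ω ∧ Q (S i ω).card} =
      (∑ A : Finset (Fin m), if Q A.card then μ.real {ω | S i ω = A} * A.card else 0) / m := by
  have hsymm : ∀ y : Fin m, μ.real {ω | y ∈ S i ω ∧ Q (S i ω).card} =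
      μ.real {ω | x ∈ S i ω ∧ Q (S i ω).card} := by
    intro y
    rw [measureReal_eq_sum_fiber (h.measurable i) (fun A => y ∈ A ∧ Q A.card),
      measureReal_eq_sum_fiber (h.measurable i) (fun A => x ∈ A ∧ Q A.card)]
    -- Transposing two attributes preserves sizes, hence the law.
    refine Fintype.sum_equiv (Equiv.finsetCongr (Equiv.swap x y)) _ _ fun A => ?_
    have hc : ((Equiv.finsetCongr (Equiv.swap x y)) A).card = A.card := by simp
    have hx : x ∈ (Equiv.finsetCongr (Equiv.swap x y)) A ↔ y ∈ A := by
      simp [Equiv.finsetCongr_apply, Finset.mem_map_equiv]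
    rw [hc, h.real_eq_of_card_eq i hc]
    simp only [hx]
  have hsum : ∑ y : Fin m, μ.real {ω | y ∈ S i ω ∧ Q (S i ω).card} =
      ∑ A : Finset (Fin m), if Q A.card then μ.real {ω | S i ω = A} * A.card else 0 := by
    simp_rw [fun y => measureReal_eq_sum_fiber (μ := μ) (h.measurable i)
      (fun A => y ∈ A ∧ Q A.card)]
    rw [Finset.sum_comm]
    refine Finset.sum_congr rfl fun A _ => ?_
    by_cases hQ : Q A.card
    · simp only [hQ, and_true, if_true]
      rw [← Finset.sum_filter, Finset.sum_const, nsmul_eq_mul, mul_comm]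
      simp
    · simp [hQ]
  have hm : (m : ℝ) ≠ 0 := by
    have := x.pos
    exact_mod_cast this.ne'
  rw [← hsum, Finset.sum_congr rfl fun y _ => hsymm y, Finset.sum_const, nsmul_eq_mul]
  simp only [Finset.card_univ, Fintype.card_fin]
  field_simp

/-- Chebyshev's inequality for the number of vertices with attribute sets in given families. -/
theorem chebyshev_card (h : IsRandomIntersectionModel μ n m P S)
    (F : Set (Finset (Fin m))) [DecidablePred (· ∈ F)] {t : ℝ} (ht : 0 < t) :
    μ.real {ω | t ≤ |((Finset.univ.filter fun i => S i ω ∈ F).card : ℝ) -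
        ∑ i, μ.real {ω | S i ω ∈ F}|} ≤ (∑ i, μ.real {ω | S i ω ∈ F}) / t ^ 2 := by
  set X : Fin n → Ω → ℝ := fun i => (fun A => if A ∈ F then (1 : ℝ) else 0) ∘ S i with hX
  have hms : ∀ i, MeasurableSet {ω | S i ω ∈ F} := fun i =>
    h.measurableSet_event (fun A => A i ∈ F)
  have hXi : ∀ i, X i = Set.indicator {ω | S i ω ∈ F} (fun _ => (1 : ℝ)) := fun i => by
    funext ω; simp [hX, Set.indicator_apply]
  have hmeas : ∀ i, Measurable (X i) := fun i => by
    rw [hXi]; exact measurable_const.indicator (hms i)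
  have hL : ∀ i, MemLp (X i) 2 μ := fun i => by
    rw [hXi]; exact (memLp_const _).indicator (hms i)
  have hind : iIndepFun X μ :=
    h.indep.comp (fun _ A => if A ∈ F then (1 : ℝ) else 0) fun _ => measurable_from_top
  have hint : ∀ i, ∫ ω, X i ω ∂μ = μ.real {ω | S i ω ∈ F} := fun i => by
    rw [hXi, integral_indicator_const _ (hms i)]; simp
  -- The variance of an indicator is at most its mean, and independence makes variances add.
  have hvar : Var[∑ i, X i; μ] ≤ ∑ i, μ.real {ω | S i ω ∈ F} := by
    rw [IndepFun.variance_sum (fun i _ => hL i) fun i _ j _ hij => hind.indepFun hij]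
    refine Finset.sum_le_sum fun i _ => ?_
    refine (variance_le_expectation_sq (hmeas i).aestronglyMeasurable).trans ?_
    rw [← hint i]
    refine le_of_eq (integral_congr_ae (Filter.Eventually.of_forall fun ω => ?_))
    simp [hX]
  have hmean : ∫ ω, (∑ i, X i) ω ∂μ = ∑ i, μ.real {ω | S i ω ∈ F} := by
    simp_rw [Finset.sum_apply]
    rw [integral_finsetSum _ fun i _ => (hL i).integrable (by norm_num)]
    exact Finset.sum_congr rfl fun i _ => hint i
  have hch := meas_ge_le_variance_div_sq (μ := μ) (X := ∑ i, X i)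
    (memLp_finsetSum' _ fun i _ => hL i) ht
  rw [hmean] at hch
  have hset : {ω | t ≤ |((Finset.univ.filter fun i => S i ω ∈ F).card : ℝ) -
        ∑ i, μ.real {ω | S i ω ∈ F}|} =
      {ω | t ≤ |(∑ i, X i) ω - ∑ i, μ.real {ω | S i ω ∈ F}|} := by
    ext ω
    simp only [Set.mem_ofPred_eq, Finset.sum_apply, hX, Function.comp, Finset.card_filter]
    push_cast
    rfl
  rw [hset, measureReal_def]
  refine (ENNReal.toReal_mono ENNReal.ofReal_ne_top hch).trans ?_
  rw [ENNReal.toReal_ofReal (div_nonneg (variance_nonneg _ _) (sq_nonneg _))]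
  gcongr

end IsRandomIntersectionModel

/-! ### Truncated means and first-moment bounds for overlaps and light vertices -/

/-- A layer-cake bound for a bounded variable with a power tail. -/
theorem integral_le_of_tail {Ω : Type*} [MeasurableSpace Ω] {μ : Measure Ω}
    [IsProbabilityMeasure μ] {f : Ω → ℝ} (hf : Integrable f μ) (hf0 : ∀ ω, 0 ≤ f ω)
    {α c₀ c₂ : ℝ} (hα : 0 < α) (hc₀ : 0 < c₀)
    (htail : ∀ t, c₀ ≤ t → μ.real {ω | t < f ω} ≤ c₂ * t ^ (-1 - α)) :
    ∫ ω, f ω ∂μ ≤ c₀ + c₂ * (c₀ ^ (-α) / α) := by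
  rw [hf.integral_eq_integral_meas_lt (Filter.Eventually.of_forall hf0)]
  have hint : IntegrableOn (fun t : ℝ => c₂ * t ^ (-1 - α)) (Set.Ioi c₀) :=
    (integrableOn_Ioi_rpow_of_lt (by linarith) hc₀).const_mul _
  have hint1 : IntegrableOn (fun _ : ℝ => (1 : ℝ)) (Set.Ioc 0 c₀) := by simp
  have hanti : Antitone fun t => μ.real {ω | t < f ω} := fun s t hst =>
    measureReal_mono (fun ω hω => lt_of_le_of_lt hst hω) (measure_ne_top _ _)
  have hm : Measurable fun t => μ.real {ω | t < f ω} := hanti.measurable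
  have hl1 : IntegrableOn (fun t => μ.real {ω | t < f ω}) (Set.Ioc 0 c₀) :=
    Integrable.mono' hint1 hm.aestronglyMeasurable (Filter.Eventually.of_forall fun t => by
      rw [Real.norm_of_nonneg measureReal_nonneg]; exact measureReal_le_one)
  have hl2 : IntegrableOn (fun t => μ.real {ω | t < f ω}) (Set.Ioi c₀) :=
    Integrable.mono' hint hm.aestronglyMeasurable <| by
      refine (ae_restrict_mem measurableSet_Ioi).mono fun t ht => ?_
      rw [Real.norm_of_nonneg measureReal_nonneg]
      exact htail t (le_of_lt ht)
  rw [← Set.Ioc_union_Ioi_eq_Ioi hc₀.le,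
    setIntegral_union (Set.Ioc_disjoint_Ioi le_rfl) measurableSet_Ioi hl1 hl2]
  refine add_le_add ?_ ?_
  · calc _ ≤ ∫ t in Set.Ioc 0 c₀, (1 : ℝ) :=
          setIntegral_mono_on hl1 hint1 measurableSet_Ioc fun t _ => measureReal_le_one
      _ = c₀ := by simp [hc₀.le]
  · calc _ ≤ ∫ t in Set.Ioi c₀, c₂ * t ^ (-1 - α) :=
          setIntegral_mono_on hl2 hint measurableSet_Ioi fun t ht => htail t (le_of_lt ht)
      _ = _ := by
        rw [integral_const_mul, integral_Ioi_rpow_of_lt (by linarith) hc₀]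
        congr 1
        rw [show -1 - α + 1 = -α by ring, neg_div_neg_eq]

namespace IsRandomIntersectionModel

variable {Ω : Type*} [MeasurableSpace Ω] {μ : Measure Ω} {n m : ℕ}
  {P : Fin n → PMF (Fin (m + 1))} {S : Fin n → Ω → Finset (Fin m)} [IsProbabilityMeasure μ]

theorem sum_mean_le (h : IsRandomIntersectionModel μ n m P S) (i : Fin n) (Q : ℕ → Prop)
    [DecidablePred Q] {s : ℝ} (hs : 0 ≤ s) (hQ : ∀ a, Q a → (a : ℝ) ≤ s) :
    (∑ A : Finset (Fin m), if Q A.card then μ.real {ω | S i ω = A} * A.card else 0) ≤ s := by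
  have h1 : ∑ A : Finset (Fin m), μ.real {ω | S i ω = A} = 1 := by
    have := measureReal_eq_sum_fiber (μ := μ) (h.measurable i) (fun _ => True)
    simpa using this.symm
  calc _ ≤ ∑ A : Finset (Fin m), μ.real {ω | S i ω = A} * s := by
        refine Finset.sum_le_sum fun A _ => ?_
        split_ifs with hA
        · exact mul_le_mul_of_nonneg_left (hQ _ hA) measureReal_nonneg
        · exact mul_nonneg measureReal_nonneg hs
    _ = s := by rw [← Finset.sum_mul, h1, one_mul]

/-- The tail bound is available only up to `T`; truncation makes it hold for every `t ≥ c₀`, so the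
layer-cake bound is independent of `T`. -/
theorem sum_truncated_mean_le (h : IsRandomIntersectionModel μ n m P S) (i : Fin n)
    {α c₀ c₂ T r : ℝ} (hα : 0 < α) (hc₀ : 0 < c₀) (hc₂ : 0 ≤ c₂) (hr : 0 < r)
    [DecidablePred fun a : ℕ => (a : ℝ) * r ≤ T]
    (htail : ∀ t ∈ Set.Icc c₀ T, μ.real {ω | t < ((S i ω).card : ℝ) * r} ≤ c₂ * t ^ (-1 - α)) :
    (∑ A : Finset (Fin m), if (A.card : ℝ) * r ≤ T then
      μ.real {ω | S i ω = A} * A.card else 0) ≤ (c₀ + c₂ * (c₀ ^ (-α) / α)) / r := by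
  set g : Finset (Fin m) → ℝ := fun A => if (A.card : ℝ) * r ≤ T then (A.card : ℝ) * r else 0
    with hg
  obtain ⟨hint, heq⟩ := integral_comp_eq_sum_fiber (μ := μ) (h.measurable i) g
  have hb := integral_le_of_tail hint (fun ω => by simp only [hg]; split_ifs <;> positivity)
    hα hc₀ (fun t ht => by
      by_cases htT : t ≤ T
      · refine (measureReal_mono (fun ω hω => ?_) (measure_ne_top _ _)).trans (htail t ⟨ht, htT⟩)
        have hω' : t < g (S i ω) := hω
        simp only [hg] at hω'
        split_ifs at hω' with h1
        · exact hω'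
        · exact absurd hω' (by linarith)
      · have : {ω | t < g (S i ω)} = ∅ := by
          ext ω
          simp only [Set.mem_ofPred_eq, Set.mem_empty_iff_false, iff_false, not_lt, hg]
          split_ifs with h1
          · linarith
          · linarith
        rw [this, measureReal_empty]
        have : 0 < t := by linarith
        positivity)
  rw [le_div_iff₀ hr, Finset.sum_mul]
  refine le_trans (le_of_eq ?_) (heq ▸ hb)
  refine Finset.sum_congr rfl fun A _ => ?_
  simp only [hg]
  split_ifs <;> ring

/-- Independence and symmetry give each attribute probability at most `(D/m)(B/m)` of being shared;
there are `m` attributes. -/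
theorem sum_real_common_le (h : IsRandomIntersectionModel μ n m P S) {u v : Fin n} (huv : u ≠ v)
    (R Q : ℕ → Prop) [DecidablePred R] [DecidablePred Q] {D B : ℝ}
    (hD0 : 0 ≤ D)
    (hD : (∑ A : Finset (Fin m), if R A.card then μ.real {ω | S u ω = A} * A.card else 0) ≤ D)
    (hB : (∑ A : Finset (Fin m), if Q A.card then μ.real {ω | S v ω = A} * A.card else 0) ≤ B) :
    ∑ x, μ.real {ω | (x ∈ S u ω ∧ R (S u ω).card) ∧ (x ∈ S v ω ∧ Q (S v ω).card)} ≤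
      D * B / m := by
  rcases Nat.eq_zero_or_pos m with rfl | hm
  · simp
  have hm' : (0 : ℝ) < m := by exact_mod_cast hm
  have hB0 : 0 ≤ ∑ A : Finset (Fin m),
      if Q A.card then μ.real {ω | S v ω = A} * A.card else 0 :=
    Finset.sum_nonneg fun A _ => by split_ifs <;> positivity
  have e : ∀ x, μ.real {ω | (x ∈ S u ω ∧ R (S u ω).card) ∧ (x ∈ S v ω ∧ Q (S v ω).card)} ≤
      D / m * (B / m) := fun x => by
    have := h.real_pair_mem huv {A | x ∈ A ∧ R A.card} {A | x ∈ A ∧ Q A.card}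
    simp only [Set.mem_ofPred_eq] at this
    rw [this, h.real_mem_eq, h.real_mem_eq]
    gcongr
  calc _ ≤ ∑ x : Fin m, D / m * (B / m) := Finset.sum_le_sum fun x _ => e x
    _ = D * B / m := by
      rw [Finset.sum_const, Finset.card_univ, Fintype.card_fin, nsmul_eq_mul]
      field_simp

/-- Markov's inequality for the number of triples (two vertices, common attribute). The restriction
`Q` is needed because only truncated means are controlled. -/
theorem real_total_overlap_le (h : IsRandomIntersectionModel μ n m P S)
    (Q : ℕ → Prop) [DecidablePred Q] {B c : ℝ} (hB0 : 0 ≤ B) (hc : 0 < c)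
    (hB : ∀ v, (∑ A : Finset (Fin m),
      if Q A.card then μ.real {ω | S v ω = A} * A.card else 0) ≤ B) :
    μ.real {ω | (∀ i, Q (S i ω).card) ∧
        c ≤ ∑ p ∈ (Finset.univ : Finset (Fin n)).offDiag, ((S p.1 ω ∩ S p.2 ω).card : ℝ)} ≤
      n ^ 2 * (B * B / m) / c := by
  classical
  set I := (Finset.univ : Finset (Fin n)).offDiag ×ˢ (Finset.univ : Finset (Fin m)) with hI
  set E : (Fin n × Fin n) × Fin m → Set Ω := fun q =>
    {ω | (q.2 ∈ S q.1.1 ω ∧ Q (S q.1.1 ω).card) ∧ (q.2 ∈ S q.1.2 ω ∧ Q (S q.1.2 ω).card)} with hE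
  have hmk := markov_card (μ := μ) I E (fun q _ => h.measurableSet_event (fun A =>
    (q.2 ∈ A q.1.1 ∧ Q (A q.1.1).card) ∧ (q.2 ∈ A q.1.2 ∧ Q (A q.1.2).card))) c
  rw [le_div_iff₀ hc, mul_comm]
  refine (mul_le_mul_of_nonneg_left (measureReal_mono ?_ (measure_ne_top _ _)) hc.le).trans
    (hmk.trans ?_)
  · rintro ω ⟨hQ, hcω⟩
    refine hcω.trans ?_
    rw [hI, Finset.card_filter, Finset.sum_product]
    push_cast
    refine Finset.sum_le_sum fun p _ => ?_
    rw [Finset.card_eq_sum_ones, ← Finset.filter_mem_eq_inter, Finset.sum_filter]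
    have : S p.1 ω = Finset.univ.filter (· ∈ S p.1 ω) := by ext; simp
    rw [this, Finset.sum_filter]
    push_cast
    refine Finset.sum_le_sum fun x _ => ?_
    have hx : ω ∈ E (p, x) ↔ x ∈ S p.1 ω ∧ x ∈ S p.2 ω := by
      simp [hE, hQ]
    simp only [hx]
    split_ifs <;> simp_all
  · rw [hI, Finset.sum_product]
    calc _ ≤ ∑ p ∈ (Finset.univ : Finset (Fin n)).offDiag, B * B / m :=
          Finset.sum_le_sum fun p hp => h.sum_real_common_le (Finset.mem_offDiag.1 hp).2.2 Q Q
            hB0 (hB _) (hB _)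
      _ ≤ _ := by
        rw [Finset.sum_const, nsmul_eq_mul]
        have : ((Finset.univ : Finset (Fin n)).offDiag.card : ℝ) ≤ n ^ 2 := by
          rw [Finset.offDiag_card]
          have : (Finset.univ : Finset (Fin n)).card * (Finset.univ : Finset (Fin n)).card -
            (Finset.univ : Finset (Fin n)).card ≤ n ^ 2 := by
            simp [sq]
          exact_mod_cast this
        gcongr

/-- A small set rarely meets any other: union bound over the neighbour and the shared attribute,
then Markov over the vertices. -/
theorem real_light_nonisolated_le (h : IsRandomIntersectionModel μ n m P S)
    (R Q : ℕ → Prop) [DecidablePred R] [DecidablePred Q] {D B c : ℝ} (hD0 : 0 ≤ D) (hB0 : 0 ≤ B)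
    (hc : 0 < c)
    (hD : ∀ v, (∑ A : Finset (Fin m),
      if R A.card then μ.real {ω | S v ω = A} * A.card else 0) ≤ D)
    (hB : ∀ v, (∑ A : Finset (Fin m),
      if Q A.card then μ.real {ω | S v ω = A} * A.card else 0) ≤ B) :
    μ.real {ω | (∀ i, Q (S i ω).card) ∧
        c ≤ ((Finset.univ.filter fun v => R (S v ω).card ∧
          ∃ j, v ≠ j ∧ (S v ω ∩ S j ω).Nonempty).card : ℝ)} ≤
      n ^ 2 * (D * B / m) / c := by
  classical
  set E : Fin n → Set Ω := fun v => {ω | R (S v ω).card ∧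
          ∃ j, v ≠ j ∧ (S v ω ∩ S j ω).Nonempty ∧ Q (S j ω).card} with hE
  have hmk := markov_card (μ := μ) Finset.univ E (fun v _ => h.measurableSet_event (fun A =>
    R (A v).card ∧ ∃ j, v ≠ j ∧ (A v ∩ A j).Nonempty ∧ Q (A j).card)) c
  have hEv : ∀ v, μ.real (E v) ≤ n * (D * B / m) := fun v => by
    have hsub : E v ⊆ ⋃ j ∈ Finset.univ.filter (fun j => v ≠ j), ⋃ x ∈ Finset.univ,
        {ω | (x ∈ S v ω ∧ R (S v ω).card) ∧ (x ∈ S j ω ∧ Q (S j ω).card)} := by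
      rintro ω ⟨hR, j, hvj, ⟨x, hx⟩, hQ⟩
      simp only [Set.mem_iUnion]
      exact ⟨j, by simpa using hvj, x, Finset.mem_univ _, ⟨(Finset.mem_inter.1 hx).1, hR⟩,
        (Finset.mem_inter.1 hx).2, hQ⟩
    refine (measureReal_mono hsub (measure_ne_top _ _)).trans
      ((measureReal_biUnion_finset_le _ _).trans ?_)
    calc _ ≤ ∑ j ∈ Finset.univ.filter (fun j => v ≠ j), D * B / m :=
          Finset.sum_le_sum fun j hj => (measureReal_biUnion_finset_le _ _).trans
            (h.sum_real_common_le (Finset.mem_filter.1 hj).2 R Q hD0 (hD _) (hB _))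
      _ ≤ _ := by
        rw [Finset.sum_const, nsmul_eq_mul]
        have : ((Finset.univ.filter (fun j => v ≠ j)).card : ℝ) ≤ n := by
          exact_mod_cast card_finset_fin_le _
        gcongr
  rw [le_div_iff₀ hc, mul_comm]
  refine (mul_le_mul_of_nonneg_left (measureReal_mono ?_ (measure_ne_top _ _)) hc.le).trans
    (hmk.trans ?_)
  · rintro ω ⟨hQ, hcω⟩
    refine hcω.trans ?_
    have : (Finset.univ.filter fun v => R (S v ω).card ∧
        ∃ j, v ≠ j ∧ (S v ω ∩ S j ω).Nonempty) ⊆ Finset.univ.filter fun v => ω ∈ E v := by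
      intro v hv
      simp only [Finset.mem_filter, Finset.mem_univ, true_and] at hv ⊢
      obtain ⟨hR, j, h1, h2⟩ := hv
      exact ⟨hR, j, h1, h2, hQ j⟩
    exact_mod_cast Finset.card_le_card this
  · refine (Finset.sum_le_sum fun v _ => hEv v).trans (le_of_eq ?_)
    rw [Finset.sum_const, Finset.card_univ, Fintype.card_fin, nsmul_eq_mul]
    ring

end IsRandomIntersectionModel

/-! ### Deterministic facts about overlaps, dense graphs and components -/

/-- Adding a vertex `a` loses at most the sum of its pairwise intersections with earlier sets.
Ordered pairs count each intersection twice, which is harmless slack. -/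
theorem sum_card_le_card_biUnion_add_overlap {V W : Type*} [DecidableEq V] [DecidableEq W]
    (S : V → Finset W) (A : Finset V) :
    ∑ v ∈ A, (S v).card ≤
      (A.biUnion S).card + ∑ p ∈ A.offDiag, (S p.1 ∩ S p.2).card := by
  induction A using Finset.induction_on with
  | empty => simp
  | insert a A ha ih =>
    rw [Finset.sum_insert ha, Finset.biUnion_insert, Finset.offDiag_insert ha]
    have h1 := Finset.card_union_add_card_inter (S a) (A.biUnion S)
    have h2 : (S a ∩ A.biUnion S).card ≤ ∑ b ∈ A, (S a ∩ S b).card := by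
      rw [Finset.inter_biUnion]; exact Finset.card_biUnion_le
    have h3 : ∑ p ∈ A.offDiag, (S p.1 ∩ S p.2).card + ∑ b ∈ A, (S a ∩ S b).card ≤
        ∑ p ∈ A.offDiag ∪ {a} ×ˢ A ∪ A ×ˢ {a}, (S p.1 ∩ S p.2).card := by
      have e : ∑ b ∈ A, (S a ∩ S b).card = ∑ p ∈ {a} ×ˢ A, (S p.1 ∩ S p.2).card := by
        rw [Finset.sum_product]; simp
      rw [e, ← Finset.sum_union]
      · exact Finset.sum_le_sum_of_subset Finset.subset_union_left
      · refine Finset.disjoint_left.2 fun p hp hq => ha ?_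
        simp only [Finset.mem_product, Finset.mem_singleton] at hq
        rw [← hq.1]
        exact (Finset.mem_offDiag.1 hp).1
    omega

/-- A graph in which any two disjoint `k`-subsets of a set of at least `3 * k` vertices are joined
by an edge has a component containing `k` of these vertices. -/
theorem exists_component_of_dense {V : Type*} [Fintype V] (G : SimpleGraph V) (X : Finset V)
    {k : ℕ} (hk : 0 < k) (hX : 3 * k ≤ X.card)
    (hG : ∀ A B : Finset V, A ⊆ X → B ⊆ X → Disjoint A B → A.card = k → B.card = k →
      ∃ a ∈ A, ∃ b ∈ B, G.Adj a b) :
    ∃ c : G.ConnectedComponent, k ≤ c.supp.ncard := by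
  classical
  by_contra! hc
  have hc' : ∀ c : G.ConnectedComponent,
      (X.filter fun x => G.connectedComponentMk x = c).card < k := fun c => by
    refine lt_of_le_of_lt ?_ (hc c)
    rw [← Set.ncard_coe_finset]
    refine Set.ncard_le_ncard (fun x hx => ?_) (Set.toFinite _)
    exact (Finset.mem_filter.1 (Finset.mem_coe.1 hx)).2
  set f : Finset G.ConnectedComponent → ℕ := fun 𝒞 =>
    (X.filter fun x => G.connectedComponentMk x ∈ 𝒞).card with hf
  have hins : ∀ 𝒞 c, f (insert c 𝒞) < f 𝒞 + k := fun 𝒞 c => by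
    have : (X.filter fun x => G.connectedComponentMk x ∈ insert c 𝒞) ⊆
        (X.filter fun x => G.connectedComponentMk x ∈ 𝒞) ∪
          (X.filter fun x => G.connectedComponentMk x = c) := by
      intro x hx
      simp only [Finset.mem_filter, Finset.mem_insert, Finset.mem_union] at hx ⊢
      tauto
    have h1 := (Finset.card_le_card this).trans (Finset.card_union_le _ _)
    have h2 := hc' c
    simp only [hf]
    omega
  -- Every component holds fewer than `k` points of `X`, so collecting components one at a time must
  -- land in `[k, 2k)`. This leaves at least `k` points of `X` in other components, and no edge
  -- crosses.
  have hex : ∀ 𝒞 : Finset G.ConnectedComponent, k ≤ f 𝒞 → ∃ 𝒟, k ≤ f 𝒟 ∧ f 𝒟 < 2 * k := by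
    intro 𝒞
    induction 𝒞 using Finset.induction_on with
    | empty => intro h; simp [hf] at h; omega
    | insert c 𝒞 hc ih =>
      intro h
      by_cases h1 : k ≤ f 𝒞
      · exact ih h1
      · have := hins 𝒞 c
        exact ⟨_, h, by omega⟩
  obtain ⟨𝒟, h1, h2⟩ := hex Finset.univ (by simp [hf]; omega)
  obtain ⟨A, hA, hAk⟩ := Finset.exists_subset_card_eq h1
  have h3 : k ≤ (X.filter fun x => G.connectedComponentMk x ∉ 𝒟).card := by
    have := Finset.card_filter_add_card_filter_not (s := X)
      (fun x => G.connectedComponentMk x ∈ 𝒟)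
    simp only [hf] at h2
    omega
  obtain ⟨B, hB, hBk⟩ := Finset.exists_subset_card_eq h3
  obtain ⟨a, ha, b, hb, hab⟩ := hG A B (hA.trans (Finset.filter_subset _ _))
    (hB.trans (Finset.filter_subset _ _))
    (Finset.disjoint_left.2 fun x hxA hxB =>
      (Finset.mem_filter.1 (hB hxB)).2 (Finset.mem_filter.1 (hA hxA)).2) hAk hBk
  have e : G.connectedComponentMk a = G.connectedComponentMk b :=
    SimpleGraph.ConnectedComponent.connectedComponentMk_eq_of_adj hab
  exact (Finset.mem_filter.1 (hB hb)).2 (e ▸ (Finset.mem_filter.1 (hA ha)).2)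

open Classical in
/-- The union of the attribute sets of the vertices in the component of `v`. -/
noncomputable def componentUnion {V W : Type*} [Fintype V] [DecidableEq W] (S : V → Finset W)
    (v : V) : Finset W :=
  (Finset.univ.filter fun j => (intersectionGraph S).Reachable v j).biUnion S

/-- Deleting the attributes of a vertex outside of the component of `v` does not change the union
of the attribute sets of this component. -/
theorem componentUnion_delete {V W : Type*} [Fintype V] [DecidableEq V] [DecidableEq W]
    (S : V → Finset W) {u v : V} (huv : ¬ (intersectionGraph S).Reachable v u) :
    componentUnion (fun i => if i ∈ Finset.univ.erase u then S i else ∅) v =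
      componentUnion S v := by
  classical
  set S' : V → Finset W := fun i => if i ∈ Finset.univ.erase u then S i else ∅ with hS'
  have hne : ∀ i, i ≠ u → S' i = S i := fun i hi => by simp [hS', hi]
  have hle : intersectionGraph S' ≤ intersectionGraph S := by
    rintro i j ⟨hij, x, hx⟩
    have hsub : ∀ i, S' i ⊆ S i := fun i => by
      simp only [hS']; split_ifs <;> simp
    exact ⟨hij, x, Finset.inter_subset_inter (hsub i) (hsub j) hx⟩
  -- A path from `v` never visits `u`, so emptying the set of `u` leaves all its edges in place.
  have hiff : ∀ j, (intersectionGraph S').Reachable v j ↔ (intersectionGraph S).Reachable v j := by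
    intro j
    refine ⟨fun h => h.mono hle, fun h => ?_⟩
    rw [SimpleGraph.reachable_iff_reflTransGen] at h
    induction h with
    | refl => exact SimpleGraph.Reachable.refl _
    | tail hvb hbc ih =>
      rename_i b c
      have hb : (intersectionGraph S).Reachable v b :=
        (SimpleGraph.reachable_iff_reflTransGen _ _).2 hvb
      have hbu : b ≠ u := fun e => huv (e ▸ hb)
      have hcu : c ≠ u := fun e => huv (e ▸ hb.trans hbc.reachable)
      refine ih.trans (SimpleGraph.Adj.reachable ⟨hbc.1, ?_⟩)
      rw [hne _ hbu, hne _ hcu]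
      exact hbc.2
  unfold componentUnion
  refine Finset.biUnion_congr (by ext j; simp [hiff]) fun j hj => hne j ?_
  rintro rfl
  exact huv (by simpa [hiff] using hj)

theorem disjoint_componentUnion {V W : Type*} [Fintype V] [DecidableEq W]
    (S : V → Finset W) {u v : V} (huv : ¬ (intersectionGraph S).Reachable v u) :
    Disjoint (S u) (componentUnion S v) := by
  rw [componentUnion, Finset.disjoint_biUnion_right]
  intro j hj
  have hj' : (intersectionGraph S).Reachable v j := by simpa using hj
  rw [Finset.disjoint_iff_inter_eq_empty]
  by_contra hne
  refine huv (hj'.trans (SimpleGraph.Adj.reachable ⟨?_, ?_⟩))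
  · rintro rfl; exact huv hj'
  · rw [Finset.inter_comm]; exact Finset.nonempty_iff_ne_empty.2 hne

/-! ### Union bounds for missed components and separated sets -/

namespace IsRandomIntersectionModel

variable {Ω : Type*} [MeasurableSpace Ω] {μ : Measure Ω} {n m : ℕ}
  {P : Fin n → PMF (Fin (m + 1))} {S : Fin n → Ω → Finset (Fin m)} [IsProbabilityMeasure μ]

/-- It is unlikely that a heavy vertex misses a component with many attributes. -/
theorem real_exists_missed_component_le (h : IsRandomIntersectionModel μ n m P S)
    (Q : ℕ → Prop) {s r : ℝ} (hs : 0 ≤ s) (hQ : ∀ a, Q a → s ≤ a) :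
    μ.real {ω | ∃ u v, Q (S u ω).card ∧ ¬ (intersectionGraph fun i => S i ω).Reachable v u ∧
      r ≤ ((componentUnion (fun i => S i ω) v).card : ℝ)} ≤
      n ^ 2 * Real.exp (-(s * r / m)) := by
  -- `M u` empties the set of `u`, so the component's attributes become a function of the other
  -- vertices and `real_cond_le` applies.
  classical
  set M : Fin n → (Fin n → Finset (Fin m)) → Fin n → Finset (Fin m) := fun u A i =>
    if i ∈ Finset.univ.erase u then A i else ∅ with hM
  have hsub : {ω | ∃ u v, Q (S u ω).card ∧
      ¬ (intersectionGraph fun i => S i ω).Reachable v u ∧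
      r ≤ ((componentUnion (fun i => S i ω) v).card : ℝ)} ⊆
      ⋃ p ∈ (Finset.univ : Finset (Fin n × Fin n)),
        {ω | r ≤ ((componentUnion (M p.1 fun i => S i ω) p.2).card : ℝ) ∧
          ∀ b ∈ ({p.1} : Finset (Fin n)), S b ω ∈
            {A : Finset (Fin m) | Q A.card ∧
              Disjoint A (componentUnion (M p.1 fun i => S i ω) p.2)}} := by
    rintro ω ⟨u, v, hu, hr, hc⟩
    simp only [Set.mem_iUnion]
    have e := componentUnion_delete (fun i => S i ω) hr
    refine ⟨(u, v), Finset.mem_univ _, ?_, ?_⟩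
    · simp only [hM]; rw [e]; exact hc
    · intro b hb
      rw [Finset.mem_singleton] at hb
      subst hb
      refine ⟨hu, ?_⟩
      simp only [hM]; rw [e]
      exact disjoint_componentUnion (fun i => S i ω) hr
  refine (measureReal_mono hsub (measure_ne_top _ _)).trans
    ((measureReal_biUnion_finset_le _ _).trans ?_)
  have hp : ∀ p : Fin n × Fin n,
      μ.real {ω | r ≤ ((componentUnion (M p.1 fun i => S i ω) p.2).card : ℝ) ∧
          ∀ b ∈ ({p.1} : Finset (Fin n)), S b ω ∈
            {A : Finset (Fin m) | Q A.card ∧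
              Disjoint A (componentUnion (M p.1 fun i => S i ω) p.2)}} ≤
        Real.exp (-(s * r / m)) := by
    intro p
    have := h.real_cond_le (T := Finset.univ.erase p.1) (U := {p.1}) (by simp)
      (fun y => r ≤ ((componentUnion y p.2).card : ℝ))
      (fun y _ => {A : Finset (Fin m) | Q A.card ∧ Disjoint A (componentUnion y p.2)})
      (Real.exp (-(s * r / m))) (by
        intro y hy
        rw [Finset.prod_singleton]
        refine (h.real_disjoint_le p.1 Q s hQ _).trans ?_
        calc _ ≤ 1 * Real.exp (-(s * (componentUnion y p.2).card / m)) := by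
              gcongr; exact measureReal_le_one
          _ ≤ _ := by rw [one_mul]; gcongr)
    refine this.trans ?_
    exact mul_le_of_le_one_right (Real.exp_pos _).le measureReal_le_one
  refine (Finset.sum_le_sum fun p _ => hp p).trans (le_of_eq ?_)
  rw [Finset.sum_const, Finset.card_univ, Fintype.card_prod, Fintype.card_fin, nsmul_eq_mul]
  push_cast
  ring

/-- It is unlikely that two disjoint sets of `k` not too light vertices are not joined. -/
theorem real_exists_separated_le (h : IsRandomIntersectionModel μ n m P S)
    (Q : ℕ → Prop) {s r p : ℝ} (hs : 0 ≤ s) (hQ : ∀ a, Q a → s ≤ a)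
    (hp : ∀ v, μ.real {ω | Q (S v ω).card} ≤ p) (k : ℕ) :
    μ.real {ω | ∃ A B : Finset (Fin n), Disjoint A B ∧ A.card = k ∧ B.card = k ∧
      (∀ a ∈ A, Q (S a ω).card) ∧ (∀ b ∈ B, Q (S b ω).card) ∧
      r ≤ ((A.biUnion fun i => S i ω).card : ℝ) ∧
      ∀ b ∈ B, Disjoint (S b ω) (A.biUnion fun i => S i ω)} ≤
      (n.choose k) ^ 2 * ((p * Real.exp (-(s * r / m))) ^ k * p ^ k) := by
  classical
  set 𝒦 := (Finset.univ : Finset (Fin n)).powersetCard k with h𝒦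
  set E : Finset (Fin n) × Finset (Fin n) → Set Ω := fun q =>
    {ω | Disjoint q.1 q.2 ∧
      (∀ a ∈ q.1, Q (S a ω).card) ∧ (∀ b ∈ q.2, Q (S b ω).card) ∧
      r ≤ ((q.1.biUnion fun i => S i ω).card : ℝ) ∧
      ∀ b ∈ q.2, Disjoint (S b ω) (q.1.biUnion fun i => S i ω)} with hE
  have hsub : {ω | ∃ A B : Finset (Fin n), Disjoint A B ∧ A.card = k ∧ B.card = k ∧
      (∀ a ∈ A, Q (S a ω).card) ∧ (∀ b ∈ B, Q (S b ω).card) ∧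
      r ≤ ((A.biUnion fun i => S i ω).card : ℝ) ∧
      ∀ b ∈ B, Disjoint (S b ω) (A.biUnion fun i => S i ω)} ⊆
      ⋃ q ∈ 𝒦 ×ˢ 𝒦, E q := by
    rintro ω ⟨A, B, hAB, hA, hB, hrest⟩
    simp only [Set.mem_iUnion]
    exact ⟨(A, B), by simp [h𝒦, Finset.mem_powersetCard, hA, hB], hAB, hrest⟩
  refine (measureReal_mono hsub (measure_ne_top _ _)).trans
    ((measureReal_biUnion_finset_le _ _).trans ?_)
  have hEq : ∀ q ∈ 𝒦 ×ˢ 𝒦, μ.real (E q) ≤ (p * Real.exp (-(s * r / m))) ^ k * p ^ k := by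
    rintro ⟨A, B⟩ hq
    rw [Finset.mem_product, Finset.mem_powersetCard, Finset.mem_powersetCard] at hq
    obtain ⟨⟨-, hA⟩, -, hB⟩ := hq
    simp only at hA hB
    by_cases hAB : Disjoint A B
    swap
    · have : E (A, B) = ∅ := by ext ω; simp [hE, hAB]
      rw [this, measureReal_empty]
      rcases Nat.eq_zero_or_pos k with rfl | hk
      · simp
      · obtain ⟨a, -⟩ := Finset.card_pos.1 (hA ▸ hk)
        have hp0 : 0 ≤ p := measureReal_nonneg.trans (hp a)
        positivity
    set H : (Fin n → Finset (Fin m)) → Prop := fun y =>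
      (∀ a ∈ A, Q (y a).card) ∧ r ≤ ((A.biUnion y).card : ℝ)
    -- Given the sets of `A`, the `k` vertices of `B` avoid their union independently. The remaining
    -- factor `p ^ k` is the cost of `Q` on `A`.
    have key := h.real_cond_le hAB H
      (fun y _ => {D : Finset (Fin m) | Q D.card ∧ Disjoint D (A.biUnion y)})
      ((p * Real.exp (-(s * r / m))) ^ k) (by
        intro y hy
        rw [← hB, ← Finset.prod_const]
        refine Finset.prod_le_prod (fun _ _ => measureReal_nonneg) fun b _ => ?_
        refine (h.real_disjoint_le b Q s hQ _).trans ?_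
        have := hy.2
        have hp0 : 0 ≤ p := measureReal_nonneg.trans (hp b)
        gcongr
        exact hp b)
    have hbi : ∀ ω, (A.biUnion fun i => if i ∈ A then S i ω else ∅) =
        A.biUnion fun i => S i ω := fun ω =>
      Finset.biUnion_congr rfl fun i hi => by simp [hi]
    have hsub1 : E (A, B) ⊆ {ω | H (fun i => if i ∈ A then S i ω else ∅) ∧
        ∀ b ∈ B, S b ω ∈ {D : Finset (Fin m) | Q D.card ∧
          Disjoint D (A.biUnion fun i => if i ∈ A then S i ω else ∅)}} := by
      rintro ω ⟨-, h1, h2, h3, h4⟩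
      refine ⟨⟨fun a ha => by simpa [ha] using h1 a ha, ?_⟩, fun b hb => ⟨h2 b hb, ?_⟩⟩
      · rw [hbi]; exact h3
      · rw [hbi]; exact h4 b hb
    have hsub2 : {ω | H (fun i => if i ∈ A then S i ω else ∅)} ⊆
        {ω | ∀ i ∈ A, S i ω ∈ {D : Finset (Fin m) | Q D.card}} := by
      rintro ω ⟨h1, -⟩ i hi
      simpa [hi] using h1 i hi
    have hH : μ.real {ω | H (fun i => if i ∈ A then S i ω else ∅)} ≤ p ^ k := by
      refine (measureReal_mono hsub2 (measure_ne_top _ _)).trans ?_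
      rw [h.real_forall_mem A (fun _ => {D : Finset (Fin m) | Q D.card}), ← hA,
        ← Finset.prod_const]
      exact Finset.prod_le_prod (fun _ _ => measureReal_nonneg) fun a _ => hp a
    refine (measureReal_mono hsub1 (measure_ne_top _ _)).trans (key.trans ?_)
    refine mul_le_mul_of_nonneg_left hH ?_
    rcases Nat.eq_zero_or_pos k with rfl | hk
    · simp
    · obtain ⟨a, -⟩ := Finset.card_pos.1 (hA ▸ hk)
      have hp0 : 0 ≤ p := measureReal_nonneg.trans (hp a)
      positivity
  refine (Finset.sum_le_sum hEq).trans (le_of_eq ?_)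
  rw [Finset.sum_const, Finset.card_product, h𝒦, Finset.card_powersetCard, Finset.card_univ,
    Fintype.card_fin, nsmul_eq_mul]
  push_cast
  ring

end IsRandomIntersectionModel

/-! ### From the typical events to the giant component -/

theorem sum_card_le_card_biUnion_add_total_overlap {n m : ℕ} (S : Fin n → Finset (Fin m))
    (A : Finset (Fin n)) :
    (∑ v ∈ A, ((S v).card : ℝ)) ≤ ((A.biUnion S).card : ℝ) +
      ∑ p ∈ (Finset.univ : Finset (Fin n)).offDiag, ((S p.1 ∩ S p.2).card : ℝ) := by
  have h1 := sum_card_le_card_biUnion_add_overlap S A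
  have h2 : ∑ p ∈ A.offDiag, (S p.1 ∩ S p.2).card ≤
      ∑ p ∈ (Finset.univ : Finset (Fin n)).offDiag, (S p.1 ∩ S p.2).card :=
    Finset.sum_le_sum_of_subset (Finset.offDiag_mono (Finset.subset_univ A))
  exact_mod_cast h1.trans (Nat.add_le_add_left h2 _)

/-- The `k` sets of `A` have total size at least `ηKn/r`, and the overlap takes at most half of it.
So a pair `A`, `B` without edges would be one of those that `hsep` excludes. -/
theorem exists_large_component {n m : ℕ} (S : Fin n → Finset (Fin m)) {r K η : ℝ} {k : ℕ}
    (hr : 0 < r) (hK : 0 < K) (hk : 0 < k) (hηk : η * n ≤ k)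
    [DecidablePred fun v => K < ((S v).card : ℝ) * r]
    (hX : 3 * k ≤ (Finset.univ.filter fun v => K < ((S v).card : ℝ) * r).card)
    (hover : ∑ p ∈ (Finset.univ : Finset (Fin n)).offDiag, ((S p.1 ∩ S p.2).card : ℝ) ≤
      η * K / 2 * (n / r))
    (hsep : ¬ ∃ A B : Finset (Fin n), Disjoint A B ∧ A.card = k ∧ B.card = k ∧
      (∀ a ∈ A, K < ((S a).card : ℝ) * r) ∧ (∀ b ∈ B, K < ((S b).card : ℝ) * r) ∧
      η * K / 2 * (n / r) ≤ ((A.biUnion S).card : ℝ) ∧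
      ∀ b ∈ B, Disjoint (S b) (A.biUnion S)) :
    ∃ c : (intersectionGraph S).ConnectedComponent, k ≤ c.supp.ncard := by
  refine exists_component_of_dense _ _ hk hX fun A B hA hB hAB hAk hBk => ?_
  have hA' : ∀ a ∈ A, K < ((S a).card : ℝ) * r := fun a ha => by simpa using hA ha
  have hB' : ∀ b ∈ B, K < ((S b).card : ℝ) * r := fun b hb => by simpa using hB hb
  by_contra! hno
  refine hsep ⟨A, B, hAB, hAk, hBk, hA', hB', ?_, fun b hb => ?_⟩
  · have h1 := sum_card_le_card_biUnion_add_total_overlap S A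
    have h2 : (k : ℝ) * (K / r) ≤ ∑ v ∈ A, ((S v).card : ℝ) := by
      rw [← hAk, ← nsmul_eq_mul]
      exact Finset.card_nsmul_le_sum _ _ _ fun a ha => ((div_lt_iff₀ hr).2 (hA' a ha)).le
    have h3 : η * K * (n / r) ≤ k * (K / r) := by
      calc η * K * (n / r) = η * n * (K / r) := by ring
        _ ≤ _ := by gcongr
    linarith
  · rw [Finset.disjoint_biUnion_right]
    intro a ha
    have hne : a ≠ b := fun e => Finset.disjoint_left.1 hAB ha (e ▸ hb)
    have := hno a ha b hb
    rw [Finset.disjoint_iff_inter_eq_empty, Finset.inter_comm]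
    by_contra hne'
    exact this ⟨hne, Finset.nonempty_iff_ne_empty.2 hne'⟩

/-- In a component with at least two vertices nobody is isolated, so `hlight` leaves at least `ρn/2`
members of weight over `δ`. Their total size is at least `δρn/(2r)`, half of which survives the
overlap; a heavy vertex outside would contradict `hmiss`. -/
theorem mem_of_isLargestComponent {n m : ℕ} (S : Fin n → Finset (Fin m)) {r ρ δ τ : ℝ} {k : ℕ}
    (hr : 0 < r) (hδ : 0 < δ) (hk : 2 ≤ k) (hρk : ρ * n < k)
    [DecidablePred fun v => ((S v).card : ℝ) * r ≤ δ ∧ ∃ j, v ≠ j ∧ (S v ∩ S j).Nonempty]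
    (hlight : ((Finset.univ.filter fun v => ((S v).card : ℝ) * r ≤ δ ∧
      ∃ j, v ≠ j ∧ (S v ∩ S j).Nonempty).card : ℝ) ≤ ρ * n / 2)
    (hover : ∑ p ∈ (Finset.univ : Finset (Fin n)).offDiag, ((S p.1 ∩ S p.2).card : ℝ) ≤
      δ * ρ / 4 * (n / r))
    (hmiss : ¬ ∃ u v, τ < ((S u).card : ℝ) * r ∧ ¬ (intersectionGraph S).Reachable v u ∧
      δ * ρ / 4 * (n / r) ≤ ((componentUnion S v).card : ℝ))
    (hcomp : ∃ c : (intersectionGraph S).ConnectedComponent, k ≤ c.supp.ncard)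
    {C : Set (Fin n)} (hC : IsLargestComponent (intersectionGraph S) C) :
    ρ * n < C.ncard ∧ ∀ u, τ < ((S u).card : ℝ) * r → u ∈ C := by
  classical
  obtain ⟨c, rfl, hmax⟩ := hC
  obtain ⟨c', hc'⟩ := hcomp
  have hkc : k ≤ c.supp.ncard := hc'.trans (hmax c')
  have hρc : ρ * n < (c.supp.ncard : ℝ) := hρk.trans_le (by exact_mod_cast hkc)
  refine ⟨hρc, fun u hu => ?_⟩
  by_contra huc
  obtain ⟨v, hv⟩ := c.nonempty_supp
  have hvc : (intersectionGraph S).connectedComponentMk v = c := hv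
  have hreach : ∀ j, (intersectionGraph S).Reachable v j ↔ j ∈ c.supp := fun j => by
    rw [SimpleGraph.ConnectedComponent.mem_supp_iff, ← hvc, SimpleGraph.ConnectedComponent.eq]
    exact ⟨fun h => h.symm, fun h => h.symm⟩
  refine hmiss ⟨u, v, hu, fun h => huc ((hreach u).1 h), ?_⟩
  set D := Finset.univ.filter fun j => j ∈ c.supp with hD
  have hDcard : D.card = c.supp.ncard := by
    rw [← Set.ncard_coe_finset]; congr 1; ext; simp [hD]
  have hU : componentUnion S v = D.biUnion S := by
    unfold componentUnion
    exact Finset.biUnion_congr (by ext j; simp [hreach, hD]) fun _ _ => rfl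
  have hnon : ∀ i ∈ D, ∃ j, i ≠ j ∧ (S i ∩ S j).Nonempty := by
    intro i hi
    obtain ⟨j, hj, hji⟩ := Finset.exists_mem_ne (s := D) (by omega) i
    have hij : (intersectionGraph S).Reachable i j :=
      ((hreach i).2 (by simpa [hD] using hi)).symm.trans ((hreach j).2 (by simpa [hD] using hj))
    rw [SimpleGraph.reachable_iff_reflTransGen] at hij
    rcases Relation.ReflTransGen.cases_head hij with e | ⟨b, hb, -⟩
    · exact absurd e.symm hji
    · exact ⟨b, hb⟩
  have hL : ((D.filter fun i => ((S i).card : ℝ) * r ≤ δ).card : ℝ) ≤ ρ * n / 2 := by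
    refine le_trans ?_ hlight
    have : (D.filter fun i => ((S i).card : ℝ) * r ≤ δ) ⊆ Finset.univ.filter fun v =>
        ((S v).card : ℝ) * r ≤ δ ∧ ∃ j, v ≠ j ∧ (S v ∩ S j).Nonempty := by
      intro i hi
      have hi' := Finset.mem_filter.1 hi
      exact Finset.mem_filter.2 ⟨Finset.mem_univ _, hi'.2, hnon i hi'.1⟩
    exact_mod_cast Finset.card_le_card this
  have hH : ρ * n / 2 ≤ ((D.filter fun i => ¬ ((S i).card : ℝ) * r ≤ δ).card : ℝ) := by
    have := Finset.card_filter_add_card_filter_not (s := D) (fun i => ((S i).card : ℝ) * r ≤ δ)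
    rw [hDcard] at this
    have h2 : ((D.filter fun i => ((S i).card : ℝ) * r ≤ δ).card : ℝ) +
        ((D.filter fun i => ¬ ((S i).card : ℝ) * r ≤ δ).card : ℝ) = c.supp.ncard := by
      exact_mod_cast this
    linarith
  have hsum : ρ * n / 2 * (δ / r) ≤ ∑ i ∈ D, ((S i).card : ℝ) := by
    calc ρ * n / 2 * (δ / r)
        ≤ ((D.filter fun i => ¬ ((S i).card : ℝ) * r ≤ δ).card : ℝ) * (δ / r) := by gcongr
      _ ≤ ∑ i ∈ D.filter fun i => ¬ ((S i).card : ℝ) * r ≤ δ, ((S i).card : ℝ) := by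
        rw [← nsmul_eq_mul]
        refine Finset.card_nsmul_le_sum _ _ _ fun i hi => ?_
        rw [div_le_iff₀ hr]
        exact (not_le.1 (Finset.mem_filter.1 hi).2).le
      _ ≤ _ := Finset.sum_le_sum_of_subset_of_nonneg (Finset.filter_subset _ _)
        fun _ _ _ => Nat.cast_nonneg _
  have h1 := sum_card_le_card_biUnion_add_total_overlap S D
  rw [hU]
  have h2 : ρ * n / 2 * (δ / r) = δ * ρ / 4 * (n / r) + δ * ρ / 4 * (n / r) := by ring
  linarith

/-- Since `k! ≥ (k/e)^k` and `n ≤ k/η`, the binomial is at most `(e/η)^k`, so the whole product is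
the `k`-th power of the base bounded in `hx`. -/
theorem choose_sq_mul_pow_le {n k : ℕ} {p η x : ℝ} (hp : 0 ≤ p) (hη : 0 < η) (hk : 0 < k)
    (hηk : η * n ≤ k) (hx : (Real.exp 1 * p / η) ^ 2 * Real.exp (-x) ≤ Real.exp (-1)) :
    ((n.choose k : ℝ)) ^ 2 * ((p * Real.exp (-x)) ^ k * p ^ k) ≤ Real.exp (-(k : ℝ)) := by
  have hk' : (0 : ℝ) < k := by exact_mod_cast hk
  have h1 : (n.choose k : ℝ) ≤ (Real.exp 1 / η) ^ k := by
    refine (Nat.choose_le_pow_div k n).trans ?_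
    have h2 := Real.pow_div_factorial_le_exp k hk'.le k
    have h3 : (n : ℝ) ≤ k / η := by rw [le_div_iff₀ hη]; linarith
    calc (n : ℝ) ^ k / k.factorial ≤ (k / η) ^ k / k.factorial := by gcongr
      _ = (k ^ k / k.factorial) / η ^ k := by rw [div_pow]; field_simp
      _ ≤ Real.exp k / η ^ k := by gcongr
      _ = _ := by rw [div_pow, ← Real.exp_nat_mul, mul_one]
  calc ((n.choose k : ℝ)) ^ 2 * ((p * Real.exp (-x)) ^ k * p ^ k)
      ≤ ((Real.exp 1 / η) ^ k) ^ 2 * ((p * Real.exp (-x)) ^ k * p ^ k) := by gcongr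
    _ = ((Real.exp 1 * p / η) ^ 2 * Real.exp (-x)) ^ k := by
      rw [← pow_mul, mul_comm k 2, pow_mul, ← mul_pow, ← mul_pow]
      congr 1; ring
    _ ≤ (Real.exp (-1)) ^ k := by gcongr
    _ = _ := by rw [← Real.exp_nat_mul]; congr 1; ring

/-! ### Counting heavy vertices and the quantitative estimate -/

namespace IsRandomIntersectionModel

variable {Ω : Type*} [MeasurableSpace Ω] {μ : Measure Ω} {n m : ℕ}
  {P : Fin n → PMF (Fin (m + 1))} {S : Fin n → Ω → Finset (Fin m)} [IsProbabilityMeasure μ]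

theorem real_exists_gt_le {T r p : ℝ} (hp : ∀ i, μ.real {ω | T < ((S i ω).card : ℝ) * r} ≤ p) :
    μ.real {ω | ¬ ∀ i, ((S i ω).card : ℝ) * r ≤ T} ≤ n * p := by
  have hsub : {ω | ¬ ∀ i, ((S i ω).card : ℝ) * r ≤ T} ⊆
      ⋃ i ∈ (Finset.univ : Finset (Fin n)), {ω | T < ((S i ω).card : ℝ) * r} := by
    intro ω hω
    obtain ⟨i, hi⟩ := not_forall.1 hω
    simp only [Set.mem_iUnion]
    exact ⟨i, Finset.mem_univ _, not_le.1 hi⟩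
  refine (measureReal_mono hsub (measure_ne_top _ _)).trans
    ((measureReal_biUnion_finset_le _ _).trans ((Finset.sum_le_sum fun i _ => hp i).trans ?_))
  simp

/-- Chebyshev with deviation one eighth of the mean. -/
theorem real_card_gt_lt_le (h : IsRandomIntersectionModel μ n m P S) {t r s : ℝ} {a : ℝ}
    (hs : 0 < s) (hsum : s ≤ ∑ i, μ.real {ω | t < ((S i ω).card : ℝ) * r}) (ha : a ≤ 7 / 8 * s)
    [∀ ω, DecidablePred fun v => t < ((S v ω).card : ℝ) * r] :
    μ.real {ω | ((Finset.univ.filter fun v => t < ((S v ω).card : ℝ) * r).card : ℝ) < a} ≤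
      64 / s := by
  classical
  set M := ∑ i, μ.real {ω | t < ((S i ω).card : ℝ) * r} with hM
  have hMpos : 0 < M := hs.trans_le hsum
  have hch := h.chebyshev_card {A : Finset (Fin m) | t < (A.card : ℝ) * r} (t := M / 8)
    (by positivity)
  have hMe : ∑ i, μ.real {ω | S i ω ∈ {A : Finset (Fin m) | t < (A.card : ℝ) * r}} = M := rfl
  rw [hMe] at hch
  have e : M / (M / 8) ^ 2 = 64 / M := by field_simp; norm_num
  rw [e] at hch
  refine (measureReal_mono ?_ (measure_ne_top _ _)).trans
    (hch.trans (div_le_div_of_nonneg_left (by norm_num) hs hsum))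
  intro ω hω
  have hω' : ((Finset.univ.filter fun v => t < ((S v ω).card : ℝ) * r).card : ℝ) < a := hω
  have key : M / 8 ≤
      |((Finset.univ.filter fun v => t < ((S v ω).card : ℝ) * r).card : ℝ) - M| := by
    rw [abs_sub_comm]
    exact le_trans (by linarith) (le_abs_self _)
  simpa using key

theorem real_card_gt_ge_le (h : IsRandomIntersectionModel μ n m P S) {t r s : ℝ}
    (hs : 0 < s) (hsum : ∑ i, μ.real {ω | t < ((S i ω).card : ℝ) * r} ≤ s)
    [∀ ω, DecidablePred fun v => t < ((S v ω).card : ℝ) * r] :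
    μ.real {ω | 2 * s ≤ ((Finset.univ.filter fun v => t < ((S v ω).card : ℝ) * r).card : ℝ)} ≤
      1 / s := by
  classical
  set M := ∑ i, μ.real {ω | t < ((S i ω).card : ℝ) * r} with hM
  have hch := h.chebyshev_card {A : Finset (Fin m) | t < (A.card : ℝ) * r} hs
  have hMe : ∑ i, μ.real {ω | S i ω ∈ {A : Finset (Fin m) | t < (A.card : ℝ) * r}} = M := rfl
  rw [hMe] at hch
  have e : M / s ^ 2 ≤ 1 / s := by
    rw [div_le_div_iff₀ (by positivity) hs]
    nlinarith
  refine (measureReal_mono ?_ (measure_ne_top _ _)).trans (hch.trans e)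
  intro ω hω
  have hω' : 2 * s ≤ ((Finset.univ.filter fun v => t < ((S v ω).card : ℝ) * r).card : ℝ) := hω
  have key : s ≤ |((Finset.univ.filter fun v => t < ((S v ω).card : ℝ) * r).card : ℝ) - M| :=
    le_trans (by linarith) (le_abs_self _)
  simpa using key

/-- A quantitative form of: every largest component has linear size and contains all the heavy
vertices. -/
theorem real_not_largest_contains_heavy_le (h : IsRandomIntersectionModel μ n m P S)
    {α c₀ c₁ c₂ T K δ ρ η τ r : ℝ} (hα : 0 < α) (hc₀ : 0 < c₀) (hc₁ : 0 < c₁) (hc₂ : 0 < c₂)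
    (hr : 0 < r) (hn : 0 < n) (hrm : r ^ 2 * m = n) (hδ : 0 < δ) (hρ : 0 < ρ) (hτ : 0 ≤ τ)
    (hK : c₀ ≤ K) (hKT : K ≤ T) (hη : η = c₁ * K ^ (-1 - α) / 4) (hηn : 6 ≤ η * n)
    (hρη : ρ < η) (hδη : δ * ρ / 4 ≤ η * K / 2)
    (hx : (Real.exp 1 * (c₂ * K ^ (-1 - α)) / η) ^ 2 * Real.exp (-(η * K ^ 2 / 2)) ≤
      Real.exp (-1))
    (htail : ∀ t ∈ Set.Icc c₀ T, ∀ i,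
      c₁ * t ^ (-1 - α) ≤ μ.real {ω | t < ((S i ω).card : ℝ) * r} ∧
      μ.real {ω | t < ((S i ω).card : ℝ) * r} ≤ c₂ * t ^ (-1 - α)) :
    μ.real {ω | ¬ ∀ C : Set (Fin n), IsLargestComponent (intersectionGraph fun i => S i ω) C →
      ρ * n < C.ncard ∧ ∀ u, τ < ((S u ω).card : ℝ) * r → u ∈ C} ≤
      n * (c₂ * T ^ (-1 - α)) + 2 * (c₀ + c₂ * (c₀ ^ (-α) / α)) / ρ * δ +
      4 * (c₀ + c₂ * (c₀ ^ (-α) / α)) ^ 2 / ρ * (r / δ) + n ^ 2 * Real.exp (-(τ * δ * ρ / 4)) +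
      64 / (4 * η * n) + Real.exp (-(η * n)) := by
  classical
  set L := c₀ + c₂ * (c₀ ^ (-α) / α) with hL
  have hL0 : 0 ≤ L := by positivity
  have hK0 : 0 < K := hc₀.trans_le hK
  have hn' : (0 : ℝ) < n := by exact_mod_cast hn
  have hη0 : 0 < η := by rw [hη]; positivity
  have hm0 : (0 : ℝ) < m := by
    rcases (Nat.cast_nonneg m : (0 : ℝ) ≤ m).lt_or_eq with h0 | h0
    · exact h0
    · rw [← h0, mul_zero] at hrm; exact absurd hrm hn'.ne
  set k := ⌈η * n⌉₊ with hk
  have hkle : η * n ≤ k := Nat.le_ceil _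
  have hklt : (k : ℝ) < η * n + 1 := Nat.ceil_lt_add_one (by linarith)
  have hk2 : 2 ≤ k := by
    have : (2 : ℝ) ≤ k := by linarith
    exact_mod_cast this
  have hcT : c₀ ≤ T := hK.trans hKT
  have hB : ∀ v, (∑ A : Finset (Fin m), if (A.card : ℝ) * r ≤ T then
      μ.real {ω | S v ω = A} * A.card else 0) ≤ L / r := fun v =>
    h.sum_truncated_mean_le v hα hc₀ hc₂.le hr fun t ht => (htail t ht v).2
  have hD : ∀ v, (∑ A : Finset (Fin m), if (A.card : ℝ) * r ≤ δ then
      μ.real {ω | S v ω = A} * A.card else 0) ≤ δ / r := fun v =>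
    h.sum_mean_le v (fun a => (a : ℝ) * r ≤ δ) (by positivity) fun a ha => (le_div_iff₀ hr).2 ha
  have b1 := real_exists_gt_le (μ := μ) (S := S) (T := T) (r := r)
    (fun i => (htail T ⟨hcT, le_rfl⟩ i).2)
  have b2 := h.real_light_nonisolated_le (fun a => (a : ℝ) * r ≤ δ) (fun a => (a : ℝ) * r ≤ T)
    (c := ρ * n / 2) (by positivity : 0 ≤ δ / r) (by positivity) (by positivity) hD hB
  have b3 := h.real_total_overlap_le (fun a => (a : ℝ) * r ≤ T) (c := δ * ρ / 4 * (n / r))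
    (by positivity) (by positivity) hB
  have b4 := h.real_exists_missed_component_le (fun a => τ < (a : ℝ) * r) (s := τ / r)
    (r := δ * ρ / 4 * (n / r)) (by positivity) fun a ha => ((div_lt_iff₀ hr).2 ha).le
  -- `3k < 3ηn + 3 ≤ (7/8)(4ηn)`, which is where `6 ≤ η * n` comes from.
  have b5 := h.real_card_gt_lt_le (t := K) (r := r) (s := 4 * η * n) (a := 3 * k)
    (by positivity) (by
      calc 4 * η * n = ∑ _i : Fin n, c₁ * K ^ (-1 - α) := by
            rw [Finset.sum_const, Finset.card_univ, Fintype.card_fin, nsmul_eq_mul, hη]; ring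
        _ ≤ _ := Finset.sum_le_sum fun i _ => (htail K ⟨hK, hKT⟩ i).1) (by linarith)
  have b6 := h.real_exists_separated_le (fun a => K < (a : ℝ) * r) (s := K / r)
    (r := η * K / 2 * (n / r)) (p := c₂ * K ^ (-1 - α)) (by positivity)
    (fun a ha => ((div_lt_iff₀ hr).2 ha).le) (fun v => (htail K ⟨hK, hKT⟩ v).2) k
  -- The relation `r² m = n` eliminates `m` from all the bounds.
  have e2 : (n : ℝ) ^ 2 * (δ / r * (L / r) / m) / (ρ * n / 2) = 2 * L / ρ * δ := by
    rw [← hrm]; field_simp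
  have e3 : (n : ℝ) ^ 2 * (L / r * (L / r) / m) / (δ * ρ / 4 * (n / r)) =
      4 * L ^ 2 / ρ * (r / δ) := by
    rw [← hrm]; field_simp
  have e4 : τ / r * (δ * ρ / 4 * (n / r)) / m = τ * δ * ρ / 4 := by
    rw [← hrm]; field_simp
  have e6 : K / r * (η * K / 2 * (n / r)) / m = η * K ^ 2 / 2 := by
    rw [← hrm]; field_simp
  rw [e2] at b2
  rw [e3] at b3
  rw [e4] at b4
  rw [e6] at b6
  have b6' := b6.trans (choose_sq_mul_pow_le (by positivity) hη0 (by omega) hkle hx)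
  have b6'' := b6'.trans (Real.exp_le_exp.2 (neg_le_neg hkle))
  -- The six failures, in order: a weight above `T`, too many light non-isolated vertices, large
  -- overlap, a missed component, too few vertices above `K`, two separated `k`-sets.
  refine (measureReal_mono ?_ (measure_ne_top _ _)).trans
    ((measureReal_union_le _ _).trans (add_le_add ((measureReal_union_le _ _).trans
    (add_le_add ((measureReal_union_le _ _).trans (add_le_add ((measureReal_union_le _ _).trans
    (add_le_add ((measureReal_union_le _ _).trans (add_le_add b1 b2)) b3)) b4)) b5)) b6''))
  intro ω hω
  by_contra hgood
  simp only [Set.mem_union, not_or] at hgood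
  obtain ⟨⟨⟨⟨⟨g1, g2⟩, g3⟩, g4⟩, g5⟩, g6⟩ := hgood
  simp only [Set.mem_ofPred_eq, not_not] at g1
  refine hω fun C hC => ?_
  have g3' : ∑ p ∈ (Finset.univ : Finset (Fin n)).offDiag,
      ((S p.1 ω ∩ S p.2 ω).card : ℝ) ≤ δ * ρ / 4 * (n / r) :=
    (not_le.1 fun hh => g3 ⟨g1, hh⟩).le
  refine mem_of_isLargestComponent (fun i => S i ω) hr hδ hk2 ?_
    (not_le.1 fun hh => g2 ⟨g1, hh⟩).le g3' g4 ?_ hC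
  · exact lt_of_lt_of_le (by gcongr) hkle
  · refine exists_large_component (fun i => S i ω) hr hK0 (by omega) hkle ?_
      (g3'.trans (by gcongr)) g6
    have : ((3 * k : ℕ) : ℝ) ≤
        ((Finset.univ.filter fun v => K < ((S v ω).card : ℝ) * r).card : ℝ) := by
      push_cast; exact not_lt.1 g5
    exact_mod_cast this

end IsRandomIntersectionModel

/-! ### Choice of parameters and asymptotics -/

/-- Only subadditivity is used, so the events need not be shown measurable. -/
theorem tendsto_real_one_of_compl_le {Ω : ℕ → Type*} [∀ n, MeasurableSpace (Ω n)]
    (μ : ∀ n, Measure (Ω n)) [∀ n, IsProbabilityMeasure (μ n)] (E : ∀ n, Set (Ω n)) {b : ℕ → ℝ}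
    (hb : Tendsto b atTop (𝓝 0)) (h : ∀ᶠ n in atTop, (μ n).real (E n)ᶜ ≤ b n) :
    Tendsto (fun n => (μ n).real (E n)) atTop (𝓝 1) := by
  have h1 : Tendsto (fun n => 1 - b n) atTop (𝓝 1) := by simpa using hb.const_sub 1
  refine tendsto_of_tendsto_of_tendsto_of_le_of_le' h1 tendsto_const_nhds ?_
    (Eventually.of_forall fun n => measureReal_le_one)
  filter_upwards [h] with n hn
  have h2 := measureReal_union_le (μ := μ n) (E n) (E n)ᶜ
  rw [Set.union_compl_self, probReal_univ] at h2
  linarith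

/-- The ratio of tail bound to `η` is `4c₂/c₁` whatever `K` is, while the exponent equals `(c₁/8)
K^(1-α)` and diverges because `α < 1`. -/
theorem exists_weight_threshold {α c₁ c₂ : ℝ} (c₀ : ℝ) (hα₁ : α < 1) (hc₁ : 0 < c₁) :
    ∃ K : ℝ, 0 < K ∧ c₀ ≤ K ∧
      (Real.exp 1 * (c₂ * K ^ (-1 - α)) / (c₁ * K ^ (-1 - α) / 4)) ^ 2 *
        Real.exp (-(c₁ * K ^ (-1 - α) / 4 * K ^ 2 / 2)) ≤ Real.exp (-1) := by
  have h1 : Tendsto (fun K : ℝ => c₁ / 8 * K ^ (1 - α)) atTop atTop :=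
    (tendsto_rpow_atTop (by linarith)).const_mul_atTop (by positivity)
  have h2 : Tendsto (fun K : ℝ => (4 * Real.exp 1 * c₂ / c₁) ^ 2 *
      Real.exp (-(c₁ / 8 * K ^ (1 - α)))) atTop (𝓝 0) := by
    simpa using (Real.tendsto_exp_neg_atTop_nhds_zero.comp h1).const_mul
      ((4 * Real.exp 1 * c₂ / c₁) ^ 2)
  obtain ⟨K, h3, h4, h5⟩ := ((h2.eventually (eventually_le_nhds (Real.exp_pos (-1)))).and
    ((eventually_gt_atTop 0).and (eventually_ge_atTop c₀))).exists
  refine ⟨K, h4, h5, le_trans (le_of_eq ?_) h3⟩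
  have h6 : K ^ (1 - α) = K ^ (-1 - α) * K ^ 2 := by
    rw [← Real.rpow_natCast K 2, ← Real.rpow_add h4]
    congr 1; push_cast; ring
  have h7 : K ^ (-1 - α) ≠ 0 := (Real.rpow_pos_of_pos h4 _).ne'
  rw [h6]
  congr 2
  · field_simp
  · congr 1; ring

theorem natCast_rpow_mul_rpow {α w : ℝ} {n : ℕ} (hα : 0 < α) (hn : 0 < n) (hw : 0 < w) :
    ((n : ℝ) ^ (1 / (1 + α)) * w) ^ (-1 - α) = w ^ (-1 - α) / n := by
  have hn' : (0 : ℝ) < n := by exact_mod_cast hn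
  have h1 : (1 + α) ≠ 0 := by positivity
  rw [Real.mul_rpow (by positivity) hw.le, ← Real.rpow_mul hn'.le]
  have : 1 / (1 + α) * (-1 - α) = -1 := by field_simp; ring
  rw [this, Real.rpow_neg_one]
  ring

/-- The constant `12/ρ` gives `τδρ/4 ≥ 3 ln n` for `δ = 1 / ln n`, enough to beat the union bound
over `n²` pairs. -/
theorem eventually_log_mul_sq_le {α ρ : ℝ} (hα₀ : 0 < α) (hα₁ : α < 1) (hρ : 0 < ρ) :
    ∀ᶠ n : ℕ in atTop, 12 / ρ * Real.log n ^ 2 ≤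
      (n : ℝ) ^ (1 / (1 + α)) / Real.log (Real.log n) ^ α := by
  have hβ : 0 < 1 / (1 + α) := by positivity
  have hlog : Tendsto (fun n : ℕ => Real.log n) atTop atTop :=
    Real.tendsto_log_atTop.comp tendsto_natCast_atTop_atTop
  have hll : Tendsto (fun n : ℕ => Real.log (Real.log n)) atTop atTop :=
    Real.tendsto_log_atTop.comp hlog
  have h1 := ((isLittleO_log_rpow_rpow_atTop 3 hβ).comp_tendsto tendsto_natCast_atTop_atTop).bound
    (show 0 < ρ / 12 by positivity)
  filter_upwards [h1, hll.eventually_ge_atTop 1, hlog.eventually_ge_atTop 1] with n h1 h2 h3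
  simp only [Function.comp] at h1
  rw [Real.norm_of_nonneg (by positivity), Real.norm_of_nonneg (by positivity)] at h1
  have h4 : Real.log (Real.log n) ^ α ≤ Real.log n :=
    calc Real.log (Real.log n) ^ α ≤ Real.log (Real.log n) ^ (1 : ℝ) :=
          Real.rpow_le_rpow_of_exponent_le h2 hα₁.le
      _ = Real.log (Real.log n) := Real.rpow_one _
      _ ≤ Real.log n := Real.log_le_self (by linarith)
  have h5 : (0 : ℝ) < Real.log (Real.log n) ^ α := Real.rpow_pos_of_pos (by linarith) _
  have h1' : Real.log n ^ 3 ≤ ρ / 12 * (n : ℝ) ^ (1 / (1 + α)) := by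
    rw [← Real.rpow_natCast]; exact_mod_cast h1
  rw [le_div_iff₀ h5]
  calc 12 / ρ * Real.log n ^ 2 * Real.log (Real.log n) ^ α
      ≤ 12 / ρ * Real.log n ^ 2 * Real.log n := by gcongr
    _ = 12 / ρ * Real.log n ^ 3 := by ring
    _ ≤ 12 / ρ * (ρ / 12 * (n : ℝ) ^ (1 / (1 + α))) := by gcongr
    _ = _ := by field_simp

theorem mainTheorem2 {Ω : ℕ → Type*} [∀ n, MeasurableSpace (Ω n)]
    (μ : ∀ n, Measure (Ω n)) [∀ n, IsProbabilityMeasure (μ n)]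
    (α c₀ c₁ c₂ : ℝ) (hα₀ : 0 < α) (hα₁ : α < 1) (hc₀ : 0 < c₀) (hc₁ : 0 < c₁) (hc₂ : 0 < c₂)
    (w : ℕ → ℝ) (hw_pos : ∀ n, 0 < w n) (hw : Tendsto w atTop atTop)
    (m : ℕ → ℕ) (P : ∀ n, Fin n → PMF (Fin (m n + 1)))
    (S : ∀ n, Fin n → Ω n → Finset (Fin (m n)))
    (hS : ∀ n, IsRandomIntersectionModel (μ n) n (m n) (P n) (S n))
    (hm : (fun n : ℕ => (n : ℝ) * Real.log n ^ 2) =o[atTop] (fun n : ℕ => (m n : ℝ)))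
    (htail : ∃ n₀ : ℕ, ∀ n > n₀, ∀ t ∈ Set.Icc c₀ ((n : ℝ) ^ (1 / (1 + α)) * w n), ∀ i : Fin n,
      c₁ * t ^ (-1 - α) ≤ (μ n).real {ω | t < normalizedWeight n (m n) (S n i ω)} ∧
      (μ n).real {ω | t < normalizedWeight n (m n) (S n i ω)} ≤ c₂ * t ^ (-1 - α)) :
    (∃ ρ ∈ Set.Ioo (0 : ℝ) 1,
      Tendsto (fun n => (μ n).real {ω | ∀ C : Set (Fin n),
        IsLargestComponent (intersectionGraph fun i => S n i ω) C → ρ * (n : ℝ) < (C.ncard : ℝ)})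
        atTop (𝓝 1)) ∧
    Tendsto (fun n => (μ n).real {ω | ∀ C : Set (Fin n),
        IsLargestComponent (intersectionGraph fun i => S n i ω) C →
          ∀ u, IsMaximalVertex (fun i => S n i ω) u → u ∈ C})
      atTop (𝓝 1) ∧
    Tendsto (fun n => (μ n).real {ω | ∀ C : Set (Fin n),
        IsLargestComponent (intersectionGraph fun i => S n i ω) C →
          heavyVertices α (fun i => S n i ω) ⊆ C})
      atTop (𝓝 1) ∧
    Tendsto (fun n => (μ n).real {ω |
        2 * c₂ * Real.log (Real.log n) ^ (α * (1 + α)) ≤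
          ((heavyVertices α (fun i => S n i ω)).ncard : ℝ)})
      atTop (𝓝 0) := by
  classical
  obtain ⟨n₀, htail⟩ := htail
  obtain ⟨K, hK0, hK, hx⟩ := exists_weight_threshold (c₂ := c₂) c₀ hα₁ hc₁
  set η := c₁ * K ^ (-1 - α) / 4 with hη
  have hη0 : 0 < η := by positivity
  -- Strictly below `η`, so that `k ≥ ηn` exceeds `ρn`; the second entry only ensures `ρ < 1`.
  set ρ := min (η / 2) (1 / 2) with hρ
  have hρ0 : 0 < ρ := by positivity
  have hρη : ρ < η := lt_of_le_of_lt (min_le_left _ _) (by linarith)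
  have hρ1 : ρ < 1 := lt_of_le_of_lt (min_le_right _ _) (by norm_num)
  have hcast : Tendsto (fun n : ℕ => (n : ℝ)) atTop atTop := tendsto_natCast_atTop_atTop
  have hlog : Tendsto (fun n : ℕ => Real.log n) atTop atTop := Real.tendsto_log_atTop.comp hcast
  have hll : Tendsto (fun n : ℕ => Real.log (Real.log n)) atTop atTop :=
    Real.tendsto_log_atTop.comp hlog
  have hN : Tendsto (fun n : ℕ => (n : ℝ) ^ (1 / (1 + α))) atTop atTop :=
    (tendsto_rpow_atTop (by positivity)).comp hcast
  have hT : Tendsto (fun n : ℕ => (n : ℝ) ^ (1 / (1 + α)) * w n) atTop atTop :=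
    hN.atTop_mul_atTop₀ hw
  set τ : ℕ → ℝ := fun n => (n : ℝ) ^ (1 / (1 + α)) / Real.log (Real.log n) ^ α with hτ
  set r : ℕ → ℝ := fun n => Real.sqrt ((n : ℝ) / (m n : ℝ)) with hr
  -- It must vanish so that light vertices seldom have neighbours, yet slowly enough that `r/δ → 0`
  -- and `τδ` dominates `ln n`.
  set δ : ℕ → ℝ := fun n => (Real.log n)⁻¹ with hδ
  have hδ0 : Tendsto δ atTop (𝓝 0) := tendsto_inv_atTop_zero.comp hlog
  have hL : Tendsto (fun n : ℕ => Real.log (Real.log n) ^ (α * (1 + α))) atTop atTop :=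
    (tendsto_rpow_atTop (by positivity)).comp hll
  have hmpos : ∀ᶠ n in atTop, (0 : ℝ) < m n := by
    filter_upwards [hm.bound one_pos, hcast.eventually_gt_atTop 0,
      hlog.eventually_gt_atTop 0] with n h1 h2 h3
    rw [Real.norm_of_nonneg (by positivity), Real.norm_of_nonneg (by positivity), one_mul] at h1
    exact lt_of_lt_of_le (by positivity) h1
  -- The square of `r/δ` is `n ln² n / m`, so this is hypothesis (i).
  have hrδ : Tendsto (fun n => r n / δ n) atTop (𝓝 0) := by
    have h1 := hm.tendsto_div_nhds_zero.sqrt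
    rw [Real.sqrt_zero] at h1
    refine h1.congr' ?_
    filter_upwards [hlog.eventually_gt_atTop 0] with n h2
    rw [hδ, div_inv_eq_mul, mul_div_right_comm, Real.sqrt_mul (by positivity),
      Real.sqrt_sq h2.le]
  have hτtail : ∀ᶠ n in atTop, ∀ i : Fin n,
      c₁ * (Real.log (Real.log n) ^ (α * (1 + α)) / n) ≤
        (μ n).real {ω | τ n < ((S n i ω).card : ℝ) * r n} ∧
      (μ n).real {ω | τ n < ((S n i ω).card : ℝ) * r n} ≤
        c₂ * (Real.log (Real.log n) ^ (α * (1 + α)) / n) := by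
    filter_upwards [eventually_gt_atTop n₀, eventually_log_mul_sq_le hα₀ hα₁ hρ0,
      hll.eventually_ge_atTop 1, hw.eventually_ge_atTop 1, hlog.eventually_ge_atTop 1,
      hlog.eventually_ge_atTop (c₀ * ρ), eventually_gt_atTop 0] with n h1 h2 h3 h4 h5 h6 h7 i
    have h8 : (1 : ℝ) ≤ Real.log (Real.log n) ^ α := Real.one_le_rpow h3 hα₀.le
    have h9 : c₀ ≤ τ n := by
      refine le_trans ?_ h2
      rw [div_mul_eq_mul_div, le_div_iff₀ hρ0]
      nlinarith
    have h10 : τ n ≤ (n : ℝ) ^ (1 / (1 + α)) * w n := by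
      have hNn : (0 : ℝ) ≤ (n : ℝ) ^ (1 / (1 + α)) := by positivity
      calc τ n ≤ (n : ℝ) ^ (1 / (1 + α)) := div_le_self hNn h8
        _ ≤ _ := le_mul_of_one_le_right hNn h4
    have h11 : τ n ^ (-1 - α) = Real.log (Real.log n) ^ (α * (1 + α)) / n := by
      have h0 : (0 : ℝ) ≤ Real.log (Real.log n) := by linarith
      simp only [hτ]
      rw [div_eq_mul_inv, natCast_rpow_mul_rpow hα₀ h7 (by positivity), ← Real.rpow_neg h0,
        ← Real.rpow_mul h0]
      congr 2; ring
    have := htail n h1 (τ n) ⟨h9, h10⟩ i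
    rw [h11] at this
    exact this
  have hmain : ∃ b : ℕ → ℝ, Tendsto b atTop (𝓝 0) ∧ ∀ᶠ n in atTop,
      (μ n).real {ω | ¬ ∀ C : Set (Fin n),
        IsLargestComponent (intersectionGraph fun i => S n i ω) C →
        ρ * n < C.ncard ∧ ∀ u, τ n < ((S n u ω).card : ℝ) * r n → u ∈ C} ≤ b n := by
    set L := c₀ + c₂ * (c₀ ^ (-α) / α) with hLdef
    refine ⟨fun n => c₂ * w n ^ (-1 - α) + 2 * L / ρ * δ n + 4 * L ^ 2 / ρ * (r n / δ n) +
      (n : ℝ)⁻¹ + 64 / (4 * η * n) + Real.exp (-(η * n)), ?_, ?_⟩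
    · have t1 : Tendsto (fun n => c₂ * w n ^ (-1 - α)) atTop (𝓝 0) := by
        have := (tendsto_rpow_neg_atTop (show 0 < 1 + α by positivity)).comp hw
        simpa [neg_add, sub_eq_add_neg, Function.comp_def, add_comm] using this.const_mul c₂
      have t2 : Tendsto (fun n => 2 * L / ρ * δ n) atTop (𝓝 0) := by
        simpa using hδ0.const_mul (2 * L / ρ)
      have t3 : Tendsto (fun n => 4 * L ^ 2 / ρ * (r n / δ n)) atTop (𝓝 0) := by
        simpa using hrδ.const_mul (4 * L ^ 2 / ρ)
      have t4 : Tendsto (fun n : ℕ => (n : ℝ)⁻¹) atTop (𝓝 0) :=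
        tendsto_inv_atTop_zero.comp hcast
      have t5 : Tendsto (fun n : ℕ => 64 / (4 * η * n)) atTop (𝓝 0) :=
        (hcast.const_mul_atTop (by positivity)).const_div_atTop 64
      have t6 : Tendsto (fun n : ℕ => Real.exp (-(η * n))) atTop (𝓝 0) :=
        Real.tendsto_exp_neg_atTop_nhds_zero.comp (hcast.const_mul_atTop hη0)
      simpa using ((((t1.add t2).add t3).add t4).add t5).add t6
    · filter_upwards [eventually_gt_atTop n₀, eventually_log_mul_sq_le hα₀ hα₁ hρ0,
        hlog.eventually_ge_atTop 1, hT.eventually_ge_atTop K, eventually_gt_atTop 0, hmpos,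
        (hcast.const_mul_atTop hη0).eventually_ge_atTop 6,
        hδ0.eventually (eventually_le_nhds (show 0 < 2 * K by positivity))]
        with n h1 h2 h3 h4 h5 h6 h7 h8
      have hn' : (0 : ℝ) < n := by exact_mod_cast h5
      have hr0 : 0 < r n := Real.sqrt_pos.2 (by positivity)
      have hrm : r n ^ 2 * m n = n := by
        rw [hr, Real.sq_sqrt (by positivity)]; field_simp
      have hτn : 12 / ρ * Real.log n ^ 2 ≤ τ n := h2
      have hτ0 : 0 ≤ τ n := le_trans (by positivity) hτn
      have hδn : 0 < δ n := inv_pos.2 (by linarith)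
      -- Lets the single overlap bound serve both the dense-graph argument and the attribute count
      -- of the component.
      have hδη : δ n * ρ / 4 ≤ η * K / 2 := by
        have : δ n * ρ ≤ 2 * K * η := mul_le_mul h8 hρη.le hρ0.le (by positivity)
        linarith
      refine ((hS n).real_not_largest_contains_heavy_le hα₀ hc₀ hc₁ hc₂ hr0 h5 hrm hδn hρ0 hτ0 hK
        h4 hη h7 hρη hδη hx (htail n h1)).trans ?_
      -- The bound on the expected number of weights above `T = n^(1/(1+α)) w n` tends to 0 because
      -- `w n → ∞`.
      have a1 : (n : ℝ) * (c₂ * ((n : ℝ) ^ (1 / (1 + α)) * w n) ^ (-1 - α)) =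
          c₂ * w n ^ (-1 - α) := by
        rw [natCast_rpow_mul_rpow hα₀ h5 (hw_pos n)]; field_simp
      have a2 : (n : ℝ) ^ 2 * Real.exp (-(τ n * δ n * ρ / 4)) ≤ (n : ℝ)⁻¹ := by
        have h9 : 3 * Real.log n ≤ τ n * δ n * ρ / 4 := by
          have : 12 / ρ * Real.log n ^ 2 * δ n * ρ / 4 ≤ τ n * δ n * ρ / 4 := by gcongr
          refine le_trans (le_of_eq ?_) this
          have : Real.log n ≠ 0 := by linarith
          simp only [hδ]
          field_simp
          norm_num
        calc (n : ℝ) ^ 2 * Real.exp (-(τ n * δ n * ρ / 4))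
            ≤ (n : ℝ) ^ 2 * Real.exp (-(3 * Real.log n)) := by gcongr
          _ = (n : ℝ) ^ 2 * ((n : ℝ) ^ 3)⁻¹ := by
            rw [Real.exp_neg, show (3 : ℝ) * Real.log n = ((3 : ℕ) : ℝ) * Real.log n by norm_num,
              Real.exp_nat_mul, Real.exp_log hn']
          _ = _ := by field_simp
      rw [a1]
      gcongr
  obtain ⟨b, hb, hbad⟩ := hmain
  have hheavy : Tendsto (fun n : ℕ => 64 / (c₁ * Real.log (Real.log n) ^ (α * (1 + α))))
      atTop (𝓝 0) := (hL.const_mul_atTop hc₁).const_div_atTop 64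
  refine ⟨⟨ρ, ⟨hρ0, hρ1⟩, ?_⟩, ?_, ?_, ?_⟩
  · refine tendsto_real_one_of_compl_le μ _ hb (hbad.mono fun n hn => le_trans ?_ hn)
    refine measureReal_mono (fun ω hω => ?_) (measure_ne_top _ _)
    exact fun hall => hω fun C hC => (hall C hC).1
  · refine tendsto_real_one_of_compl_le μ _ (b := fun n => b n +
      64 / (c₁ * Real.log (Real.log n) ^ (α * (1 + α)))) (by simpa using hb.add hheavy) ?_
    filter_upwards [hbad, hτtail, hL.eventually_ge_atTop (2 / c₁), eventually_gt_atTop 0]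
      with n h1 h2 h3 h4
    have hn' : (0 : ℝ) < n := by exact_mod_cast h4
    have h3' : 2 ≤ c₁ * Real.log (Real.log n) ^ (α * (1 + α)) := by
      rw [div_le_iff₀ hc₁] at h3; linarith
    -- The mean number of vertices above `τ` is at least `c₁ (ln ln n)^(α(1+α)) → ∞`, so with high
    -- probability one exists and every maximal vertex lies above `τ`. The threshold `2/c₁` ensures
    -- `1 ≤ 7/8 * s`.
    have h5 := (hS n).real_card_gt_lt_le (t := τ n) (r := r n) (a := 1)
      (s := c₁ * Real.log (Real.log n) ^ (α * (1 + α))) (by linarith) (by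
        calc _ = ∑ _i : Fin n, c₁ * (Real.log (Real.log n) ^ (α * (1 + α)) / n) := by
              rw [Finset.sum_const, Finset.card_univ, Fintype.card_fin, nsmul_eq_mul]
              field_simp
          _ ≤ _ := Finset.sum_le_sum fun i _ => (h2 i).1) (by linarith)
    refine le_trans (measureReal_mono ?_ (measure_ne_top _ _))
      ((measureReal_union_le _ _).trans (add_le_add h1 h5))
    intro ω hω
    by_contra hgood
    simp only [Set.mem_union, not_or, Set.mem_ofPred_eq, not_not, not_lt] at hgood
    obtain ⟨g1, g2⟩ := hgood
    refine hω fun C hC u hu => (g1 C hC).2 u ?_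
    obtain ⟨v, hv⟩ := Finset.card_pos.1 (by exact_mod_cast (zero_lt_one.trans_le g2) :
      0 < (Finset.univ.filter fun v => τ n < ((S n v ω).card : ℝ) * r n).card)
    refine (Finset.mem_filter.1 hv).2.trans_le ?_
    have : ((S n v ω).card : ℝ) ≤ (S n u ω).card := by exact_mod_cast hu v
    exact mul_le_mul_of_nonneg_right this (Real.sqrt_nonneg _)
  · refine tendsto_real_one_of_compl_le μ _ hb (hbad.mono fun n hn => le_trans ?_ hn)
    refine measureReal_mono (fun ω hω => ?_) (measure_ne_top _ _)
    exact fun hall => hω fun C hC u hu => (hall C hC).2 u hu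
  · have h0 : Tendsto (fun n : ℕ => 1 / (c₂ * Real.log (Real.log n) ^ (α * (1 + α))))
        atTop (𝓝 0) := (hL.const_mul_atTop hc₂).const_div_atTop 1
    refine squeeze_zero' (Eventually.of_forall fun n => measureReal_nonneg) ?_ h0
    filter_upwards [hτtail, hL.eventually_gt_atTop 0, eventually_gt_atTop 0] with n h2 h3 h4
    have hn' : (0 : ℝ) < n := by exact_mod_cast h4
    have h5 := (hS n).real_card_gt_ge_le (t := τ n) (r := r n)
      (s := c₂ * Real.log (Real.log n) ^ (α * (1 + α))) (by positivity) (by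
        calc _ ≤ ∑ _i : Fin n, c₂ * (Real.log (Real.log n) ^ (α * (1 + α)) / n) :=
              Finset.sum_le_sum fun i _ => (h2 i).2
          _ = _ := by
              rw [Finset.sum_const, Finset.card_univ, Fintype.card_fin, nsmul_eq_mul]
              field_simp)
    refine le_trans (measureReal_mono (fun ω hω => ?_) (measure_ne_top _ _)) h5
    have hcard : (heavyVertices α (fun i => S n i ω)).ncard =
        (Finset.univ.filter fun v => τ n < ((S n v ω).card : ℝ) * r n).card := by
      rw [← Set.ncard_coe_finset]
      congr 1
      ext v
      simp [heavyVertices, normalizedWeight, hτ, hr]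
    have hω' : 2 * c₂ * Real.log (Real.log n) ^ (α * (1 + α)) ≤
      ((heavyVertices α (fun i => S n i ω)).ncard : ℝ) := hω
    rw [hcard] at hω'
    rw [Set.mem_ofPred_eq]
    linarith
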